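/- All graphs are finite and simple, logarithms are to base $2$, and a path may consist of a single vertex. A set $\mathcal P$ of paths connects $S$ to $T$ if every path in it has one endpoint in $S$ and the other in $T$ (or is a single vertex of $S\cap T$); paths are node-disjoint if no two of them share a vertex. Definitions. Let $A,B,X$ be disjoint vertex sets of a graph $H$ and $\rho>0$ an integer. An $(A,B,X)$-crossbar of width $\rho$ consists of $\rho$ node-disjoint paths $P_1,\dots,P_\rho$ connecting $A$ to $B$ and $\rho$ node-disjoint paths $Q_1,\dots,Q_\rho$, where $Q_i$ connects a vertex of $P_i$ to a vertex of $X$, such that $P_i$ and $Q_j$ are disjoint for $i\ne j$, and $P_i\cap Q_i$ is a single vertex, which is an endpoint of $Q_i$. A vertex set $T$ is node-well-linked in a graph $G$ if for all disjoint $T',T''\subseteq T$ there are $\min\{|T'|,|T''|\}$ node-disjoint paths in $G$ connecting $T'$ to $T''$. Disjoint vertex sets $A,B$ are linked in $G$ if for all $A'\subseteq A$, $B'\subseteq B$ there are $\min\{|A'|,|B'|\}$ node-disjoint paths in $G$ connecting $A'$ to $B'$. A Path-of-Sets System of length $\ell>0$ and width $w>0$ in a graph $G$ consists of mutually disjoint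 connected subgraphs $C_1,\dots,C_\ell$ of $G$; for each $1\le i\le\ell$, two disjoint sets $A_i,B_i\subseteq V(C_i)$ with $|A_i|=|B_i|=w$; and, for each $1\le i<\ell$, a set $\mathcal P_i$ of $w$ paths connecting $B_i$ to $A_{i+1}$, such that all paths in $\bigcup_i\mathcal P_i$ are node-disjoint, and every vertex of such a path that lies in $\bigcup_j V(C_j)$ is an endpoint of the path. It is strong if for each $i$ the sets $A_i$ and $B_i$ are each node-well-linked in $C_i$, and $(A_i,B_i)$ are linked in $C_i$. Theorem. There is a universal constant $c>0$ such that the following holds. Let $H$ be a graph and let $g\ge 2$ be an integral power of $2$. Let $A,B,X$ be three disjoint sets of vertices of $H$, each of cardinality $\kappa\ge 2^{22}g^9\log g$, such that every vertex of $X$ has degree $1$ in $H$. Suppose that there is a set of $\kappa$ node-disjoint paths in $H$ connecting $A$ to $B$, and a set of $\kappa$ node-disjoint paths in $H$ connecting $A$ to $X$ (paths of the first set may intersect paths of the second). Then either $H$ contains an $(A,B,X)$-crossbar of width $g^2$, or there is a minor $H'$ of $H$ that contains a strong Path-of-Sets System of length at least $c\,g^2$ and width at least $c\,g^2$. -/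

import Mathlib

/-!
Graphs are finite simple graphs.  Paths are `SimpleGraph.Path`s, i.e. walks without repeated
vertices; a path may consist of a single vertex.
-/

universe u v

namespace CrossbarThm

/-- There is a set of `k` pairwise node-disjoint paths of `G`, each connecting a vertex of `S` to a
vertex of `T` (a path consisting of a single vertex must lie in `S ∩ T`). -/
def HasDisjointPaths {V : Type u} (G : SimpleGraph V) (S T : Set V) (k : ℕ) : Prop :=
  ∃ (s t : Fin k → V) (P : ∀ i, G.Path (s i) (t i)),
    (∀ i, s i ∈ S) ∧ (∀ i, t i ∈ T) ∧
    Pairwise fun i j => (P i).1.support.Disjoint (P j).1.support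

/-- `T` is node-well-linked in the (finite) graph `G`. -/
def NodeWellLinked {V : Type u} (G : SimpleGraph V) (T : Set V) : Prop :=
  ∀ T₁ T₂ : Set V, T₁ ⊆ T → T₂ ⊆ T → Disjoint T₁ T₂ →
    HasDisjointPaths G T₁ T₂ (min T₁.ncard T₂.ncard)

/-- The (disjoint) vertex sets `A` and `B` are node-linked in the (finite) graph `G`. -/
def NodeLinked {V : Type u} (G : SimpleGraph V) (A B : Set V) : Prop :=
  ∀ A' B' : Set V, A' ⊆ A → B' ⊆ B → HasDisjointPaths G A' B' (min A'.ncard B'.ncard)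

/-- A Path-of-Sets System of length `ℓ` and width `w` in `G`.  Indices start at `0`. -/
structure PathOfSetsSystem {V : Type u} (G : SimpleGraph V) (ℓ w : ℕ) where
  length_pos : 0 < ℓ
  width_pos : 0 < w
  /-- The clusters: mutually disjoint connected subgraphs of `G`. -/
  C : Fin ℓ → G.Subgraph
  C_connected : ∀ i, (C i).Connected
  C_disjoint : Pairwise fun i j => Disjoint (C i).verts (C j).verts
  A : Fin ℓ → Set V
  B : Fin ℓ → Set V
  A_subset : ∀ i, A i ⊆ (C i).verts
  B_subset : ∀ i, B i ⊆ (C i).verts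
  A_disjoint_B : ∀ i, Disjoint (A i) (B i)
  A_ncard : ∀ i, (A i).ncard = w
  B_ncard : ∀ i, (B i).ncard = w
  /-- For every `i` with `i + 1 < ℓ`, the endpoints of `w` paths from `B i` to `A (i + 1)`. -/
  src : Fin (ℓ - 1) → Fin w → V
  tgt : Fin (ℓ - 1) → Fin w → V
  P : ∀ i k, G.Path (src i k) (tgt i k)
  src_mem : ∀ i k, src i k ∈ B ⟨i.1, Nat.lt_of_lt_pred i.2⟩
  tgt_mem : ∀ i k, tgt i k ∈ A ⟨i.1 + 1, Nat.add_lt_of_lt_sub i.2⟩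
  /-- All the paths, for all `i`, are node-disjoint. -/
  P_disjoint : Pairwise fun p q : Fin (ℓ - 1) × Fin w =>
    (P p.1 p.2).1.support.Disjoint (P q.1 q.2).1.support
  /-- The paths are internally disjoint from all the clusters. -/
  P_internal : ∀ i k j, ∀ x ∈ (P i k).1.support, x ∈ (C j).verts → x = src i k ∨ x = tgt i k

/-- A Path-of-Sets System is strong if, inside each cluster `C i`, each of `A i`, `B i` is
node-well-linked and `(A i, B i)` are linked. -/
def PathOfSetsSystem.IsStrong {V : Type u} {G : SimpleGraph V} {ℓ w : ℕ}
    (S : PathOfSetsSystem G ℓ w) : Prop :=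
  ∀ i, NodeWellLinked (S.C i).coe (Subtype.val ⁻¹' S.A i) ∧
    NodeWellLinked (S.C i).coe (Subtype.val ⁻¹' S.B i) ∧
    NodeLinked (S.C i).coe (Subtype.val ⁻¹' S.A i) (Subtype.val ⁻¹' S.B i)

/-- An `(A, B, X)`-crossbar of width `ρ` in `H`: node-disjoint paths `P i` from `A` to `B`, and
node-disjoint paths `Q i` from a vertex `q i` of `P i` to `X`, such that `P i` and `Q j` are
disjoint for `i ≠ j`, and `P i`, `Q i` have only the endpoint `q i` of `Q i` in common. -/
structure Crossbar {V : Type u} (H : SimpleGraph V) (A B X : Set V) (ρ : ℕ) where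
  a : Fin ρ → V
  b : Fin ρ → V
  q : Fin ρ → V
  x : Fin ρ → V
  P : ∀ i, H.Path (a i) (b i)
  Q : ∀ i, H.Path (q i) (x i)
  a_mem : ∀ i, a i ∈ A
  b_mem : ∀ i, b i ∈ B
  q_mem : ∀ i, q i ∈ (P i).1.support
  x_mem : ∀ i, x i ∈ X
  P_disjoint : Pairwise fun i j => (P i).1.support.Disjoint (P j).1.support
  Q_disjoint : Pairwise fun i j => (Q i).1.support.Disjoint (Q j).1.support
  P_disjoint_Q : Pairwise fun i j => (P i).1.support.Disjoint (Q j).1.support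
  P_inter_Q : ∀ i, ∀ y ∈ (P i).1.support, y ∈ (Q i).1.support → y = q i

/-- `H'` is a minor of `H`: there is a model of `H'` in `H`, with pairwise disjoint connected
(in particular nonempty) branch sets, and an edge of `H` between the branch sets of the endpoints
of every edge of `H'`. -/
def IsMinor {W : Type v} {V : Type u} (H' : SimpleGraph W) (H : SimpleGraph V) : Prop :=
  ∃ φ : W → Set V,
    (∀ w, (H.induce (φ w)).Connected) ∧
    (Pairwise fun w w' => Disjoint (φ w) (φ w')) ∧
    ∀ w w', H'.Adj w w' → ∃ x ∈ φ w, ∃ y ∈ φ w', H.Adj x y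

end CrossbarThm

/-! The second alternative is found inside `H` itself, with length and width `g ^ 2`. Suppose that
there is no crossbar of width `ρ = g ^ 2`. Contract a subfamily of the A–B paths `P i` to points and
apply Menger towards `X`: `ρ` disjoint paths would lift to a crossbar, so fewer than `ρ` vertices
separate, some of them contracted paths (`exists_layer`). Discarding these paths and repeating
yields `L` disjoint layers of fewer than `ρ` paths each. Every walk to `X` from a vertex of `A`
outside the layers meets each layer, either in one of its paths or in one of fewer than `ρ` extra
vertices (`exists_layers`). So `q` disjoint A–X paths starting outside the layers have many
incidences with the `P i` (`exists_dense_linkSystem`).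

These `q` paths are rerouted in an edge-minimal subgraph that keeps all edges inside the sets `V(P
i)` and a linkage of order `q`. By minimality every other edge of the linkage crosses a tight cut,
that is, one of order `q`. Tight sets are closed under union and intersection, and no `P i` meeting
two linkage paths fits between consecutive ones (`not_between`). A chain of tight sets therefore
cuts the graph into many slices, each containing many of the `P i` (`exists_slices`). In every slice
the incidence graph between linkage paths and `P i` has a subgraph that stays connected after
deleting `w` vertices on each side (`exists_robust_subpair`). This subgraph is a cluster: by Menger,
sets of at most `w` vertices on distinct segments are linked in it.

It remains to join clusters by `w` disjoint paths. If the first and last cluster of a family cannot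
be joined, the small cut between them splits the family into two parts sharing at most `w` linkage
paths (`exists_split`). Each cluster uses at least `s` of only `q` paths, so a family without
joinable pairs is small. Grading clusters by the longest chain ending there then produces a long
chain of joined clusters (`exists_linked_chain`), which is a strong Path-of-Sets System. -/

namespace CrossbarThm

/-! ### Menger's theorem for vertex sets, stated with vertex boundaries. -/

section Menger

variable {V : Type u}

/-- The edges of `G` with both ends in `Z`. -/
def within (G : SimpleGraph V) (Z : Set V) : SimpleGraph V where
  Adj a b := G.Adj a b ∧ a ∈ Z ∧ b ∈ Z
  symm := ⟨fun _ _ h => ⟨h.1.symm, h.2.2, h.2.1⟩⟩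
  loopless := ⟨fun _ h => h.1.ne rfl⟩

theorem within_le (G : SimpleGraph V) (Z : Set V) : within G Z ≤ G := fun _ _ h => h.1

theorem within_mono {G G' : SimpleGraph V} (h : G ≤ G') (Z : Set V) : within G Z ≤ within G' Z :=
  fun _ _ hab => ⟨h hab.1, hab.2⟩

theorem mem_of_mem_support_within {G : SimpleGraph V} {Z : Set V} {a b : V}
    (w : (within G Z).Walk a b) (ha : a ∈ Z) : ∀ v ∈ w.support, v ∈ Z := by
  induction w with
  | nil => intro v hv; simp at hv; exact hv ▸ ha
  | cons h p ih =>
    intro v hv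
    rw [SimpleGraph.Walk.support_cons, List.mem_cons] at hv
    rcases hv with rfl | hv
    · exact ha
    · exact ih h.2.2 v hv

open Classical in
/-- The vertices of `U` that lie in `T` or have a neighbour outside `U`. -/
noncomputable def bdry (G : SimpleGraph V) (T : Set V) (U : Finset V) : Finset V :=
  U.filter fun a => a ∈ T ∨ ∃ b, b ∉ U ∧ G.Adj a b

theorem mem_bdry {G : SimpleGraph V} {T : Set V} {U : Finset V} {a : V} :
    a ∈ bdry G T U ↔ a ∈ U ∧ (a ∈ T ∨ ∃ b, b ∉ U ∧ G.Adj a b) := by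
  simp [bdry]

theorem exists_mem_bdry {G : SimpleGraph V} {T : Set V} {U : Finset V} {a b : V}
    (w : G.Walk a b) (ha : a ∈ U) (hb : b ∈ T) : ∃ v ∈ w.support, v ∈ bdry G T U := by
  induction w with
  | nil => exact ⟨_, by simp, mem_bdry.2 ⟨ha, Or.inl hb⟩⟩
  | @cons a c b h p ih =>
    by_cases hc : c ∈ U
    · obtain ⟨v, hv, hv'⟩ := ih hc hb
      exact ⟨v, by simp [hv], hv'⟩
    · exact ⟨a, by simp, mem_bdry.2 ⟨ha, Or.inr ⟨c, hc, h⟩⟩⟩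

theorem HasDisjointPaths.le_card_of_meets {G : SimpleGraph V} {S T : Set V} {k : ℕ}
    (h : HasDisjointPaths G S T k) {Y : Finset V}
    (hY : ∀ a ∈ S, ∀ b ∈ T, ∀ w : G.Walk a b, ∃ v ∈ w.support, v ∈ Y) : k ≤ Y.card := by
  obtain ⟨s, t, P, hs, ht, hP⟩ := h
  choose f hf hfY using fun i => hY _ (hs i) _ (ht i) (P i).1
  have hinj : Function.Injective f := by
    intro i j hij
    by_contra hne
    exact hP hne (hf i) (hij ▸ hf j)
  have := Finset.card_le_card_of_injOn (s := Finset.univ) f (fun i _ => hfY i) hinj.injOn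
  simpa using this

theorem HasDisjointPaths.le_card_bdry {G : SimpleGraph V} {S T : Set V} {k : ℕ}
    (h : HasDisjointPaths G S T k) {U : Finset V} (hU : S ⊆ U) : k ≤ (bdry G T U).card :=
  h.le_card_of_meets fun _ ha _ hb w => exists_mem_bdry w (hU ha) hb

theorem HasDisjointPaths.mono {G G' : SimpleGraph V} (hG : G ≤ G') {S T : Set V} {k : ℕ}
    (h : HasDisjointPaths G S T k) : HasDisjointPaths G' S T k := by
  obtain ⟨s, t, P, hs, ht, hP⟩ := h
  refine ⟨s, t, fun i => ⟨(P i).1.mapLe hG, (P i).2.mapLe hG⟩, hs, ht, fun i j hij => ?_⟩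
  simpa using hP hij

open Classical in
theorem HasDisjointPaths.of_walks {G : SimpleGraph V} {S T : Set V} {k : ℕ} (s t : Fin k → V)
    (w : ∀ i, G.Walk (s i) (t i)) (hs : ∀ i, s i ∈ S) (ht : ∀ i, t i ∈ T)
    (hw : Pairwise fun i j => (w i).support.Disjoint (w j).support) :
    HasDisjointPaths G S T k := by
  refine ⟨s, t, fun i => (w i).toPath, hs, ht, fun i j hij v hi hj => ?_⟩
  exact hw hij ((w i).support_bypass_subset_support hi) ((w j).support_bypass_subset_support hj)

open Classical in
-- A shortest choice works: a second vertex of `S` or of `T` allows the walk to be cut there.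
-- Trimming is what later keeps connecting paths internally disjoint from contracted vertices and
-- from clusters.
theorem exists_trimmed_path {G : SimpleGraph V} {S T : Set V} {a b : V} (w : G.Walk a b)
    (ha : a ∈ S) (hb : b ∈ T) : ∃ (a' b' : V) (p : G.Path a' b'), a' ∈ S ∧ b' ∈ T ∧
      p.1.support ⊆ w.support ∧ ∀ v ∈ p.1.support, (v ∈ S → v = a') ∧ (v ∈ T → v = b') := by
  induction hn : w.length using Nat.strong_induction_on generalizing a b with
  | _ n ih =>
    by_cases h1 : ∃ v ∈ w.support, v ∈ S ∧ v ≠ a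
    · obtain ⟨v, hv, hvS, hva⟩ := h1
      obtain ⟨a', b', p, h⟩ := ih (w.dropUntil v hv).length
        (hn ▸ SimpleGraph.Walk.length_dropUntil_lt_length hv hva) (w.dropUntil v hv) hvS hb rfl
      exact ⟨a', b', p, h.1, h.2.1,
        fun x hx => w.support_dropUntil_subset_support hv (h.2.2.1 hx), h.2.2.2⟩
    by_cases h2 : ∃ v ∈ w.support, v ∈ T ∧ v ≠ b
    · obtain ⟨v, hv, hvT, hvb⟩ := h2
      obtain ⟨a', b', p, h⟩ := ih (w.takeUntil v hv).length
        (hn ▸ SimpleGraph.Walk.length_takeUntil_lt_length hv hvb) (w.takeUntil v hv) ha hvT rfl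
      exact ⟨a', b', p, h.1, h.2.1,
        fun x hx => w.support_takeUntil_subset_support hv (h.2.2.1 hx), h.2.2.2⟩
    push Not at h1 h2
    exact ⟨a, b, w.toPath, ha, hb, w.support_bypass_subset_support, fun v hv =>
      ⟨h1 v (w.support_bypass_subset_support hv), h2 v (w.support_bypass_subset_support hv)⟩⟩

theorem HasDisjointPaths.trimmed {G : SimpleGraph V} {S T : Set V} {k : ℕ}
    (h : HasDisjointPaths G S T k) : ∃ (s t : Fin k → V) (P : ∀ i, G.Path (s i) (t i)),
      (∀ i, s i ∈ S) ∧ (∀ i, t i ∈ T) ∧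
      (Pairwise fun i j => (P i).1.support.Disjoint (P j).1.support) ∧
      ∀ i, ∀ v ∈ (P i).1.support, (v ∈ S → v = s i) ∧ (v ∈ T → v = t i) := by
  obtain ⟨s, t, P, hs, ht, hP⟩ := h
  choose s' t' P' hs' ht' hsub htrim using fun i => exists_trimmed_path (P i).1 (hs i) (ht i)
  exact ⟨s', t', P', hs', ht', fun i j hij v hi hj => hP hij (hsub i hi) (hsub j hj), htrim⟩

theorem HasDisjointPaths.start_injective {G : SimpleGraph V} {k : ℕ} {s t : Fin k → V}
    (P : ∀ i, G.Path (s i) (t i))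
    (hP : Pairwise fun i j => (P i).1.support.Disjoint (P j).1.support) :
    Function.Injective s := by
  intro i j hij
  by_contra hne
  exact hP hne (P i).1.start_mem_support (show s i ∈ (P j).1.support by rw [hij]; exact (P j).1.start_mem_support)

theorem HasDisjointPaths.end_injective {G : SimpleGraph V} {k : ℕ} {s t : Fin k → V}
    (P : ∀ i, G.Path (s i) (t i))
    (hP : Pairwise fun i j => (P i).1.support.Disjoint (P j).1.support) :
    Function.Injective t := by
  intro i j hij
  by_contra hne
  exact hP hne (P i).1.end_mem_support (show t i ∈ (P j).1.support by rw [hij]; exact (P j).1.end_mem_support)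

theorem exists_eq_of_injective {k : ℕ} {f : Fin k → V} (hf : Function.Injective f)
    {Y : Finset V} (hY : ∀ i, f i ∈ Y) (hk : Y.card ≤ k) {v : V} (hv : v ∈ Y) : ∃ i, f i = v := by
  classical
  have h1 : Finset.univ.image f ⊆ Y := by
    intro x hx
    obtain ⟨i, -, rfl⟩ := Finset.mem_image.1 hx
    exact hY i
  have h2 := Finset.eq_of_subset_of_card_le h1 (by
    rw [Finset.card_image_of_injective _ hf]; simpa using hk)
  rw [← h2] at hv
  obtain ⟨i, -, h⟩ := Finset.mem_image.1 hv
  exact ⟨i, h⟩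

/-- Linkages on the two sides of a cut that is tight after deleting the edge `xy` are joined to a
linkage of the whole graph. -/
theorem HasDisjointPaths.glue {G : SimpleGraph V} {S T : Set V} {k : ℕ} {x y : V}
    (hxy : G.Adj x y) {U Y : Finset V} [DecidableEq V] (hSU : S ⊆ U) (hYU : Y ⊆ U)
    (hyU : y ∉ U) (hxY : x ∉ Y) (hk : Y.card + 1 = k)
    (h1 : HasDisjointPaths (within G U) S (insert x Y : Finset V) k)
    (h2 : HasDisjointPaths (within G ((U : Set V)ᶜ ∪ Y)) (insert y Y : Finset V) T k) :
    HasDisjointPaths G S T k := by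
  obtain ⟨s, t, P, hs, ht, hP⟩ := h1
  obtain ⟨s', t', P', hs', ht', hP'⟩ := h2
  have hyY : y ∉ Y := fun h => hyU (hYU h)
  have hx : (insert x Y).card ≤ k := by rw [Finset.card_insert_of_notMem hxY]; omega
  have hy : (insert y Y).card ≤ k := by rw [Finset.card_insert_of_notMem hyY]; omega
  have hj : ∀ i, ∃ j, (t i = x ∧ s' j = y) ∨ (t i ∈ Y ∧ s' j = t i) := by
    intro i
    rcases Finset.mem_insert.1 (Finset.mem_coe.1 (ht i)) with h | h
    · obtain ⟨j, hj⟩ := exists_eq_of_injective (start_injective P' hP') hs' hy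
        (Finset.mem_insert_self y Y)
      exact ⟨j, Or.inl ⟨h, hj⟩⟩
    · obtain ⟨j, hj⟩ := exists_eq_of_injective (start_injective P' hP') hs' hy
        (Finset.mem_insert_of_mem h)
      exact ⟨j, Or.inr ⟨h, hj⟩⟩
  choose j hj using hj
  have hjinj : Function.Injective j := by
    intro a b hab
    apply end_injective P hP
    rcases hj a with ha | ha <;> rcases hj b with hb | hb
    · rw [ha.1, hb.1]
    · rw [hab, hb.2] at ha; exact absurd (ha.2 ▸ hb.1) hyY
    · rw [← hab, ha.2] at hb; exact absurd (hb.2 ▸ ha.1) hyY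
    · rw [← ha.2, ← hb.2, hab]
  have hw : ∀ i, ∃ w : G.Walk (s i) (t' (j i)),
      ∀ v ∈ w.support, v ∈ (P i).1.support ∨ v ∈ (P' (j i)).1.support := by
    intro i
    have hl := within_le G (U : Set V)
    have hr := within_le G ((U : Set V)ᶜ ∪ Y)
    rcases hj i with ⟨h, h'⟩ | ⟨-, h⟩
    · have e : G.Adj (t i) (s' (j i)) := by rw [h, h']; exact hxy
      refine ⟨((P i).1.mapLe hl).append (.cons e ((P' (j i)).1.mapLe hr)), fun v hv => ?_⟩
      rw [SimpleGraph.Walk.mem_support_append_iff] at hv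
      simp only [SimpleGraph.Walk.support_mapLe_eq_support, SimpleGraph.Walk.support_cons,
        List.mem_cons] at hv
      rcases hv with hv | rfl | hv
      · exact Or.inl hv
      · exact Or.inl (P i).1.end_mem_support
      · exact Or.inr hv
    · refine ⟨((P i).1.mapLe hl).append (((P' (j i)).1.mapLe hr).copy h rfl), fun v hv => ?_⟩
      rw [SimpleGraph.Walk.mem_support_append_iff] at hv
      simpa using hv
  choose w hw using hw
  -- Left paths stay in `U` and right paths in the complement of `U` together with `Y`, so a common
  -- vertex lies in `Y`. By counting, every vertex of `Y` is the end of a left path and the start of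
  -- a right path, and those two are matched to each other.
  have key : ∀ a b v, v ∈ (P a).1.support → v ∈ (P' (j b)).1.support → a = b := by
    intro a b v ha hb
    have h1 : v ∈ U := mem_of_mem_support_within (P a).1 (hSU (hs a)) v ha
    have h2 := mem_of_mem_support_within (P' (j b)).1 (by
      have := hs' (j b)
      rw [Finset.coe_insert] at this
      rcases this with h | h
      · exact Or.inl (by rw [h]; simpa using hyU)
      · exact Or.inr h) v hb
    have hvY : v ∈ Y := h2.resolve_left (fun h => h h1)
    obtain ⟨a', ha'⟩ := exists_eq_of_injective (end_injective P hP) ht hx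
      (Finset.mem_insert_of_mem hvY)
    obtain ⟨b', hb'⟩ := exists_eq_of_injective (start_injective P' hP') hs' hy
      (Finset.mem_insert_of_mem hvY)
    have e1 : a = a' := by
      by_contra hne
      exact hP hne ha (ha' ▸ (P a').1.end_mem_support)
    have e2 : j b = b' := by
      by_contra hne
      exact hP' hne hb (hb' ▸ (P' b').1.start_mem_support)
    subst e1
    apply hjinj
    apply start_injective P' hP'
    rw [e2, hb']
    rcases hj a with h | h
    · exact absurd (h.1 ▸ ha' ▸ hvY) hxY
    · rw [h.2, ha']
  refine HasDisjointPaths.of_walks s (t' ∘ j) w hs (fun i => ht' _) fun a b hab v ha hb => ?_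
  rcases hw a v ha with h | h <;> rcases hw b v hb with h' | h'
  · exact hP hab h h'
  · exact hab (key _ _ _ h h')
  · exact hab (key _ _ _ h' h).symm
  · exact hP' (fun h => hab (hjinj h)) h h'

theorem hasDisjointPaths_of_edgeless [Fintype V] {G : SimpleGraph V} {S T : Set V} {k : ℕ}
    (hG : ∀ a b, ¬ G.Adj a b) (h : ∀ U : Finset V, S ⊆ U → k ≤ (bdry G T U).card) :
    HasDisjointPaths G S T k := by
  classical
  have h1 := h (Finset.univ.filter (· ∈ S)) (by intro x hx; simpa using hx)
  obtain ⟨Y, hY, hYk⟩ := Finset.exists_subset_card_eq h1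
  have hmem : ∀ v ∈ Y, v ∈ S ∧ v ∈ T := by
    intro v hv
    have := mem_bdry.1 (hY hv)
    simp only [hG, and_false, exists_false, or_false, Finset.mem_filter, Finset.mem_univ,
      true_and] at this
    exact this
  let e := (Y.equivFinOfCardEq hYk).symm
  refine HasDisjointPaths.of_walks (fun i => (e i : V)) (fun i => (e i : V))
    (fun i => .nil) (fun i => (hmem _ (e i).2).1) (fun i => (hmem _ (e i).2).2) ?_
  intro i j hij
  have : (e i : V) ≠ e j := fun h => hij (e.injective (Subtype.ext h))
  intro v hv hv'
  simp only [SimpleGraph.Walk.support_nil, List.mem_singleton] at hv hv'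
  exact this (hv ▸ hv')

/-- **Menger's theorem** for sets of vertices, in terms of vertex boundaries. -/
theorem menger [Fintype V] (G : SimpleGraph V) (S T : Set V) (k : ℕ)
    (h : ∀ U : Finset V, S ⊆ U → k ≤ (bdry G T U).card) : HasDisjointPaths G S T k := by
  classical
  induction hn : G.edgeSet.ncard using Nat.strong_induction_on generalizing G S T with
  | _ n ih =>
  by_cases hE : ∀ a b, ¬ G.Adj a b
  · exact hasDisjointPaths_of_edgeless hE h
  push Not at hE
  obtain ⟨x, y, hxy⟩ := hE
  have hlt : ∀ G' : SimpleGraph V, G' ≤ G.deleteEdges {s(x, y)} → G'.edgeSet.ncard < n := by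
    intro G' hG'
    rw [← hn]
    apply Set.ncard_lt_ncard _ (Set.toFinite _)
    rw [SimpleGraph.edgeSet_ssubset_edgeSet]
    refine lt_of_le_of_lt hG' (lt_of_le_of_ne (SimpleGraph.deleteEdges_le _) fun he => ?_)
    have h1 := hxy
    rw [← he] at h1
    simp at h1
  by_cases h' : ∀ U : Finset V, S ⊆ U → k ≤ (bdry (G.deleteEdges {s(x, y)}) T U).card
  · exact (ih _ (hlt _ le_rfl) _ S T h' rfl).mono (SimpleGraph.deleteEdges_le _)
  push Not at h'
  obtain ⟨U, hSU, hUk⟩ := h'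
  -- The deleted edge must cross the failing set `U`, since otherwise the boundary of `U` would be
  -- just as small in `G`. The names are chosen so that `x` is the end inside `U`.
  obtain ⟨x, y, hxy, hxU, hyU, hlt, hUk⟩ : ∃ x y, G.Adj x y ∧ x ∈ U ∧ y ∉ U ∧
      (∀ G' : SimpleGraph V, G' ≤ G.deleteEdges {s(x, y)} → G'.edgeSet.ncard < n) ∧
      (bdry (G.deleteEdges {s(x, y)}) T U).card < k := by
    by_cases h1 : x ∈ U ∧ y ∉ U
    · exact ⟨x, y, hxy, h1.1, h1.2, hlt, hUk⟩
    by_cases h2 : y ∈ U ∧ x ∉ U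
    · rw [Sym2.eq_swap] at hUk hlt
      exact ⟨y, x, hxy.symm, h2.1, h2.2, hlt, hUk⟩
    exfalso
    refine absurd (h U hSU) (not_le.2 (lt_of_le_of_lt (Finset.card_le_card ?_) hUk))
    intro a ha
    obtain ⟨haU, haT | ⟨b, hb, hab⟩⟩ := mem_bdry.1 ha
    · exact mem_bdry.2 ⟨haU, Or.inl haT⟩
    · refine mem_bdry.2 ⟨haU, Or.inr ⟨b, hb, ?_⟩⟩
      rw [SimpleGraph.deleteEdges_adj]
      refine ⟨hab, fun he => ?_⟩
      rcases Sym2.eq_iff.1 (Set.mem_singleton_iff.1 he) with ⟨rfl, rfl⟩ | ⟨rfl, rfl⟩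
      · exact h1 ⟨haU, hb⟩
      · exact h2 ⟨haU, hb⟩
  set G' := G.deleteEdges {s(x, y)} with hG'
  have hadj : ∀ a b, G.Adj a b → G'.Adj a b ∨ (a = x ∧ b = y) ∨ (a = y ∧ b = x) := by
    intro a b hab
    by_cases he : s(a, b) = s(x, y)
    · exact Or.inr (Sym2.eq_iff.1 he)
    · exact Or.inl (by rw [hG', SimpleGraph.deleteEdges_adj]; exact ⟨hab, he⟩)
  set Y := bdry G' T U with hYdef
  have hYU : Y ⊆ U := fun v hv => (mem_bdry.1 hv).1
  have hsub : bdry G T U ⊆ insert x Y := by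
    intro a ha
    obtain ⟨haU, haT | ⟨b, hb, hab⟩⟩ := mem_bdry.1 ha
    · exact Finset.mem_insert_of_mem (mem_bdry.2 ⟨haU, Or.inl haT⟩)
    · rcases hadj a b hab with h1 | ⟨rfl, rfl⟩ | ⟨rfl, rfl⟩
      · exact Finset.mem_insert_of_mem (mem_bdry.2 ⟨haU, Or.inr ⟨b, hb, h1⟩⟩)
      · exact Finset.mem_insert_self _ _
      · exact absurd haU hyU
  have hcard := (h U hSU).trans (Finset.card_le_card hsub)
  have hxY : x ∉ Y := fun hx => by rw [Finset.insert_eq_of_mem hx] at hcard; omega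
  rw [Finset.card_insert_of_notMem hxY] at hcard
  have hG'le : G' ≤ G := SimpleGraph.deleteEdges_le _
  -- `Y` has exactly `k - 1` vertices, and `x` or `y` supplies the missing one on either side. The
  -- cut conditions of the two smaller problems follow from that of `G` applied to `U₁ ∩ U` and to
  -- `U ∪ U₁`.
  refine HasDisjointPaths.glue hxy hSU hYU hyU hxY (by omega)
    (HasDisjointPaths.mono (G := within G' U) (within_mono hG'le _)
      (ih _ (hlt _ (within_le _ _)) _ _ _ ?_ rfl))
    (HasDisjointPaths.mono (G := within G' ((U : Set V)ᶜ ∪ Y))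
      (within_mono hG'le _) (ih _ (hlt _ (within_le _ _)) _ _ _ ?_ rfl))
  · intro U₁ hU₁
    refine (h (U₁ ∩ U) fun v hv => ?_).trans (Finset.card_le_card fun a ha => ?_)
    · simpa using ⟨hU₁ hv, hSU hv⟩
    obtain ⟨haU, ha⟩ := mem_bdry.1 ha
    rw [Finset.mem_inter] at haU
    refine mem_bdry.2 ⟨haU.1, ?_⟩
    rcases ha with haT | ⟨b, hb, hab⟩
    · exact Or.inl (by simpa using Or.inr (mem_bdry.2 ⟨haU.2, Or.inl haT⟩))
    · rcases hadj a b hab with h1 | ⟨rfl, rfl⟩ | ⟨rfl, rfl⟩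
      · by_cases hbU : b ∈ U
        · exact Or.inr ⟨b, fun h => hb (Finset.mem_inter.2 ⟨h, hbU⟩), h1, haU.2, hbU⟩
        · exact Or.inl (by simpa using Or.inr (mem_bdry.2 ⟨haU.2, Or.inr ⟨b, hbU, h1⟩⟩))
      · exact Or.inl (by simp)
      · exact absurd haU.2 hyU
  · intro U₁ hU₁
    rw [Finset.coe_subset, Finset.insert_subset_iff] at hU₁
    refine (h (U ∪ U₁) fun v hv => ?_).trans (Finset.card_le_card fun a ha => ?_)
    · simpa using Or.inl (hSU hv)
    obtain ⟨haU, ha⟩ := mem_bdry.1 ha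
    have hYa : a ∈ Y → a ∈ U₁ := fun h => hU₁.2 h
    rcases ha with haT | ⟨b, hb, hab⟩
    · refine mem_bdry.2 ⟨?_, Or.inl haT⟩
      rcases Finset.mem_union.1 haU with h1 | h1
      · exact hYa (mem_bdry.2 ⟨h1, Or.inl haT⟩)
      · exact h1
    · have hbU : b ∉ U := fun h => hb (Finset.mem_union_left _ h)
      have hbU₁ : b ∉ U₁ := fun h => hb (Finset.mem_union_right _ h)
      rcases hadj a b hab with h1 | ⟨rfl, rfl⟩ | ⟨rfl, rfl⟩
      · by_cases haU' : a ∈ U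
        · have : a ∈ Y := mem_bdry.2 ⟨haU', Or.inr ⟨b, hbU, h1⟩⟩
          exact mem_bdry.2 ⟨hYa this, Or.inr ⟨b, hbU₁, h1, Or.inr this, Or.inl (by simpa using hbU)⟩⟩
        · refine mem_bdry.2 ⟨(Finset.mem_union.1 haU).resolve_left haU',
            Or.inr ⟨b, hbU₁, h1, Or.inl (by simpa using haU'), Or.inl (by simpa using hbU)⟩⟩
      · exact absurd hU₁.1 hbU₁
      · exact absurd hxU hbU

end Menger

/-! ### Layers of A–B paths that separate from `X`, obtained from the absence of a crossbar. -/

section Layers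

variable {V : Type u}

/-- The simple graph obtained from `H` by identifying the vertices with the same image under `π`. -/
def contractAlong (H : SimpleGraph V) (π : V → V) : SimpleGraph V where
  Adj a b := a ≠ b ∧ ∃ v v', π v = a ∧ π v' = b ∧ H.Adj v v'
  symm := ⟨fun _ _ ⟨hne, v, v', h, h', hv⟩ => ⟨hne.symm, v', v, h', h, hv.symm⟩⟩
  loopless := ⟨fun _ h => h.1 rfl⟩

theorem mem_range_of_walk_contractAlong {H : SimpleGraph V} {π : V → V} {x y : V}
    (w : (contractAlong H π).Walk x y) (hx : x ∈ Set.range π) :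
    ∀ v ∈ w.support, v ∈ Set.range π := by
  induction w with
  | nil => intro v hv; simp at hv; exact hv ▸ hx
  | cons h p ih =>
    intro v hv
    rw [SimpleGraph.Walk.support_cons, List.mem_cons] at hv
    rcases hv with rfl | hv
    · exact hx
    · obtain ⟨-, -, u, -, hu, -⟩ := h
      exact ih ⟨u, hu⟩ v hv

theorem exists_lift_walk {H : SimpleGraph V} {π : V → V} {x y : V}
    (w : (contractAlong H π).Walk x y) (h : ∀ v ∈ w.support, ∀ u, π u = v → u = v) :
    ∃ w' : H.Walk x y, w'.support = w.support := by
  induction w with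
  | nil => exact ⟨.nil, rfl⟩
  | @cons a c b hac p ih =>
    obtain ⟨w', hw'⟩ := ih fun v hv => h v (by simp [hv])
    have ha := h a (by simp)
    have hc := h c (by simp)
    have hac' := hac
    obtain ⟨-, v, v', hv, hv', hadj⟩ := hac'
    have e := ha v hv
    have e' := hc v' hv'
    subst e e'
    exact ⟨.cons hadj w', by simp [hw']⟩

theorem exists_mem_bdry_contractAlong {H : SimpleGraph V} {π : V → V} {T : Set V} {U : Finset V}
    {x y : V} (w : H.Walk x y) (hx : π x ∈ U) (hy : π y ∈ T) :
    ∃ v ∈ w.support, π v ∈ bdry (contractAlong H π) T U := by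
  induction w with
  | nil => exact ⟨_, by simp, mem_bdry.2 ⟨hx, Or.inl hy⟩⟩
  | @cons a c b h p ih =>
    by_cases hc : π c ∈ U
    · obtain ⟨v, hv, hv'⟩ := ih hc hy
      exact ⟨v, by simp [hv], hv'⟩
    · exact ⟨a, by simp, mem_bdry.2 ⟨hx, Or.inr ⟨π c, hc, fun he => hc (he ▸ hx), a, c, rfl, rfl, h⟩⟩⟩

variable {H : SimpleGraph V} {A B X : Set V} {κ : ℕ} {a b : Fin κ → V}

/-- Linkages to `X` from distinct members of a family of disjoint paths, avoiding the other members,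
form a crossbar. -/
theorem nonempty_crossbar (P : ∀ i, H.Path (a i) (b i)) (ha : ∀ i, a i ∈ A) (hb : ∀ i, b i ∈ B)
    (hP : Pairwise fun i j => (P i).1.support.Disjoint (P j).1.support) {D : Finset (Fin κ)}
    {ρ : ℕ} (m : Fin ρ → Fin κ) (hm : Function.Injective m) (hD : ∀ k, m k ∈ D) (q x : Fin ρ → V)
    (Q : ∀ k, H.Walk (q k) (x k)) (hx : ∀ k, x k ∈ X) (hq : ∀ k, q k ∈ (P (m k)).1.support)
    (hQP : ∀ k, ∀ v ∈ (Q k).support, ∀ i ∈ D, v ∈ (P i).1.support → v = q k)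
    (hQ : ∀ k l, k ≠ l → ∀ v ∈ (Q k).support, v ∈ (Q l).support → v = q k ∨ v = q l) :
    Nonempty (Crossbar H A B X ρ) := by
  classical
  have key : ∀ k l, k ≠ l → ∀ v, v ∈ (P (m k)).1.support → v ∉ (Q l).support := by
    intro k l hkl v hv hv'
    obtain rfl := hQP l v hv' _ (hD k) hv
    exact hP (fun h => hkl (hm h)) hv (hq l)
  have hb' := fun k => (Q k).support_bypass_subset_support
  refine ⟨⟨a ∘ m, b ∘ m, q, x, fun k => P (m k), fun k => (Q k).toPath, fun k => ha _,
    fun k => hb _, hq, hx, fun k l hkl => hP (fun h => hkl (hm h)), fun k l hkl v hv hv' => ?_,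
    fun k l hkl v hv hv' => key k l hkl v hv (hb' _ hv'),
    fun k v hv hv' => hQP k v (hb' _ hv') _ (hD k) hv⟩⟩
  rcases hQ k l hkl v (hb' _ hv) (hb' _ hv') with rfl | rfl
  · exact key k l hkl _ (hq k) (hb' _ hv')
  · exact key l k hkl.symm _ (hq l) (hb' _ hv)

open Classical in
/-- The map sending the vertices of the paths `P i`, `i ∈ D`, to the first vertex of the path. -/
noncomputable def collapse (P : ∀ i, H.Path (a i) (b i)) (D : Finset (Fin κ)) (v : V) : V :=
  if h : ∃ i ∈ D, v ∈ (P i).1.support then a h.choose else v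

theorem collapse_of_mem (P : ∀ i, H.Path (a i) (b i))
    (hP : Pairwise fun i j => (P i).1.support.Disjoint (P j).1.support) {D : Finset (Fin κ)}
    {i : Fin κ} (hi : i ∈ D) {v : V} (hv : v ∈ (P i).1.support) : collapse P D v = a i := by
  have h : ∃ i ∈ D, v ∈ (P i).1.support := ⟨i, hi, hv⟩
  rw [collapse, dif_pos h]
  by_contra hne
  exact hP (fun he => hne (congrArg a he)) h.choose_spec.2 hv

theorem collapse_of_notMem (P : ∀ i, H.Path (a i) (b i)) {D : Finset (Fin κ)}
    {v : V} (hv : ∀ i ∈ D, v ∉ (P i).1.support) : collapse P D v = v := by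
  rw [collapse, dif_neg]
  push Not
  exact hv

theorem mem_of_collapse_eq (P : ∀ i, H.Path (a i) (b i))
    (hP : Pairwise fun i j => (P i).1.support.Disjoint (P j).1.support) {D : Finset (Fin κ)}
    {i : Fin κ} {v : V} (hv : collapse P D v = a i) : v ∈ (P i).1.support := by
  by_cases h : ∃ j ∈ D, v ∈ (P j).1.support
  · obtain ⟨j, hj, hvj⟩ := h
    rw [collapse_of_mem P hP hj hvj] at hv
    exact HasDisjointPaths.start_injective P hP hv ▸ hvj
  · push Not at h
    rw [collapse_of_notMem P h] at hv
    exact hv ▸ (P i).1.start_mem_support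

/-- Contract each `P i`, `i ∈ D`, to its first vertex and apply Menger towards `X`. Trimmed disjoint
paths of the contraction meet contracted vertices only at their starts, so they lift to the second
family of a crossbar. Otherwise some boundary has fewer than `ρ` vertices: it serves as `Y`, and the
contracted vertices in it determine `S`. -/
theorem exists_layer [Fintype V] (P : ∀ i, H.Path (a i) (b i)) (ha : ∀ i, a i ∈ A)
    (hb : ∀ i, b i ∈ B) (hP : Pairwise fun i j => (P i).1.support.Disjoint (P j).1.support)
    {ρ : ℕ} (hno : ¬ Nonempty (Crossbar H A B X ρ)) (D : Finset (Fin κ)) :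
    ∃ (S : Finset (Fin κ)) (Y : Finset V), S ⊆ D ∧ S.card < ρ ∧ Y.card < ρ ∧
      ∀ i ∈ D, ∀ x ∈ X, ∀ w : H.Walk (a i) x,
        (∃ v ∈ w.support, v ∈ Y) ∨ ∃ v ∈ w.support, ∃ s ∈ S, v ∈ (P s).1.support := by
  classical
  set π := collapse P D with hπ
  have hainj := HasDisjointPaths.start_injective P hP
  have hsrc : ∀ i ∈ D, π (a i) = a i := fun i hi =>
    collapse_of_mem P hP hi (P i).1.start_mem_support
  by_cases h : ∀ U : Finset V, a '' D ⊆ U → ρ ≤ (bdry (contractAlong H π) (π '' X) U).card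
  · exfalso
    apply hno
    obtain ⟨s, t, Q, hs, ht, hQ, htrim⟩ := (menger _ _ _ _ h).trimmed
    choose m hmD hm using hs
    have hlift : ∀ i ∈ D, ∀ u y (Q : (contractAlong H π).Walk u y), u = a i → Q.IsPath →
        y ∈ π '' X → (∀ v ∈ Q.support, v ∈ a '' D → v = u) →
        ∃ (q x : V) (w : H.Walk q x), x ∈ X ∧ q ∈ (P i).1.support ∧
        (∀ v ∈ w.support, ∀ i ∈ D, v ∈ (P i).1.support → v = q) ∧
        ∀ v ∈ w.support, v = q ∨ v ∈ Q.support := by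
      rintro i hi u y Q hu hQk ⟨x, hxX, hx⟩ htr
      have hrange := mem_range_of_walk_contractAlong Q ⟨a i, by rw [hsrc _ hi, hu]⟩
      rcases Q with _ | ⟨hadj, p⟩
      -- A trivial path in the contraction means that `X` meets `P i`; the lifted path is that
      -- single vertex of `X`.
      · refine ⟨x, x, .nil, hxX, mem_of_collapse_eq P hP (D := D) ?_, by simp +contextual,
          by simp +contextual⟩
        rw [← hπ, hx, hu]
      · rename_i c
        rw [SimpleGraph.Walk.cons_isPath_iff] at hQk
        have hp : ∀ v ∈ p.support, (∀ i ∈ D, v ∉ (P i).1.support) ∧ ∀ u, π u = v → u = v := by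
          intro v hv
          have h1 : ∀ u, π u = v → ∀ i ∈ D, u ∉ (P i).1.support := by
            intro u hu i hi hui
            have h2 : v = a i := by rw [← hu, hπ, collapse_of_mem P hP hi hui]
            have := htr v (by simp [hv]) ⟨i, hi, h2.symm⟩
            exact hQk.2 (this ▸ hv)
          have h2 : ∀ u, π u = v → u = v := fun u hu => by
            rw [← hu, hπ, collapse_of_notMem P (h1 u hu)]
          obtain ⟨u, hu⟩ := hrange v (by simp [hv])
          exact ⟨h2 u hu ▸ h1 u hu, h2⟩
        obtain ⟨p', hp'⟩ := exists_lift_walk p fun v hv => (hp v hv).2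
        have hadj' := hadj
        obtain ⟨-, v, v', hv, hv', hvv⟩ := hadj'
        have e := (hp c (by simp)).2 v' hv'
        subst e
        have hxt : x = y := (hp _ p.end_mem_support).2 x hx
        refine ⟨v, y, .cons hvv p', hxt ▸ hxX,
          mem_of_collapse_eq P hP (D := D) (by rw [← hπ, hv, hu]), ?_, ?_⟩
        · intro u hu i hi hui
          rw [SimpleGraph.Walk.support_cons, List.mem_cons, hp'] at hu
          exact hu.resolve_right fun h => (hp u h).1 i hi hui
        · intro u hu
          rw [SimpleGraph.Walk.support_cons, List.mem_cons, hp'] at hu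
          exact hu.imp id fun h => by simp [h]
    replace hlift := fun k => hlift (m k) (hmD k) _ _ (Q k).1 (hm k).symm (Q k).2 (ht k)
      fun v hv => (htrim k v hv).1
    choose q x w hx hq hQP hsub using hlift
    have hminj : Function.Injective m := by
      intro k l hkl
      apply HasDisjointPaths.start_injective Q hQ
      rw [← hm k, ← hm l, hkl]
    refine nonempty_crossbar P ha hb hP m hminj hmD q x w hx hq hQP fun k l hkl v hv hv' => ?_
    rcases hsub k v hv with h | h
    · exact Or.inl h
    rcases hsub l v hv' with h' | h'
    · exact Or.inr h'
    exact (hQ hkl h h').elim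
  · push Not at h
    obtain ⟨U, hU, hUρ⟩ := h
    refine ⟨D.filter (fun i => a i ∈ bdry (contractAlong H π) (π '' X) U),
      bdry (contractAlong H π) (π '' X) U, Finset.filter_subset _ _, lt_of_le_of_lt ?_ hUρ, hUρ, ?_⟩
    · exact Finset.card_le_card_of_injOn a (fun i hi => (Finset.mem_filter.1 hi).2) hainj.injOn
    · intro i hi x hx w
      obtain ⟨v, hv, hvb⟩ := exists_mem_bdry_contractAlong (π := π) (T := π '' X) (U := U) w
        (by rw [hsrc i hi]; exact hU ⟨i, hi, rfl⟩) ⟨x, hx, rfl⟩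
      by_cases hvD : ∃ j ∈ D, v ∈ (P j).1.support
      · obtain ⟨j, hj, hvj⟩ := hvD
        rw [hπ, collapse_of_mem P hP hj hvj] at hvb
        exact Or.inr ⟨v, hv, j, Finset.mem_filter.2 ⟨hj, hvb⟩, hvj⟩
      · push Not at hvD
        rw [hπ, collapse_of_notMem P hvD] at hvb
        exact Or.inl ⟨v, hv, hvb⟩

/-- Iterates `exists_layer`, each time removing the paths of the layer just found. The layers are
thus disjoint, so incidences with different layers can be added up. -/
theorem exists_layers [Fintype V] (P : ∀ i, H.Path (a i) (b i)) (ha : ∀ i, a i ∈ A)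
    (hb : ∀ i, b i ∈ B) (hP : Pairwise fun i j => (P i).1.support.Disjoint (P j).1.support)
    {ρ : ℕ} (hno : ¬ Nonempty (Crossbar H A B X ρ)) :
    ∃ (S : ℕ → Finset (Fin κ)) (Y : ℕ → Finset V),
      (∀ k, (S k).card < ρ) ∧ (∀ k, (Y k).card < ρ) ∧ (∀ j k, j < k → Disjoint (S j) (S k)) ∧
      ∀ k i, (∀ j < k, i ∉ S j) → ∀ x ∈ X, ∀ w : H.Walk (a i) x,
        (∃ v ∈ w.support, v ∈ Y k) ∨ ∃ v ∈ w.support, ∃ s ∈ S k, v ∈ (P s).1.support := by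
  classical
  choose F Y hFD hF hY hw using exists_layer P ha hb hP hno
  let D : ℕ → Finset (Fin κ) := fun k => Nat.rec Finset.univ (fun _ D => D \ F D) k
  have hD : ∀ k, D (k + 1) = D k \ F (D k) := fun _ => rfl
  have hanti : Antitone D := antitone_nat_of_succ_le fun k => by
    rw [hD]; exact Finset.sdiff_subset
  refine ⟨fun k => F (D k), fun k => Y (D k), fun k => hF _, fun k => hY _, fun j k hjk => ?_,
    fun k i hi => hw _ _ ?_⟩
  · refine (Finset.disjoint_sdiff (s := F (D j)) (t := D j)).mono_right ?_
    exact (hFD _).trans (hanti hjk)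
  · induction k with
    | zero => exact Finset.mem_univ _
    | succ k ih =>
      rw [hD, Finset.mem_sdiff]
      exact ⟨ih fun j hj => hi j (by omega), hi k (by omega)⟩

/-- The number of paths of the family `R` that meet the set `C`. -/
noncomputable def hitCount {q : ℕ} (R : Fin q → Set V) (C : Set V) : ℕ :=
  {i | (R i ∩ C).Nonempty}.ncard

/-- Disjointness of the sets `R i` lets `Y` account for fewer than `ρ` of them; all others are
counted in some `hitCount`. -/
theorem card_le_sum_hitCount {q ρ : ℕ} {R : Fin q → Set V}
    (hR : Pairwise fun i j => Disjoint (R i) (R j)) {C : Fin κ → Set V} {S : Finset (Fin κ)}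
    {Y : Finset V} (hY : Y.card < ρ)
    (h : ∀ i, (∃ v ∈ R i, v ∈ Y) ∨ ∃ v ∈ R i, ∃ s ∈ S, v ∈ C s) :
    q ≤ ∑ s ∈ S, hitCount R (C s) + ρ := by
  classical
  have h1 : (Finset.univ : Finset (Fin q)) ⊆
      (Finset.univ.filter fun i => ∃ v ∈ R i, v ∈ Y) ∪
        S.biUnion fun s => Finset.univ.filter fun i => (R i ∩ C s).Nonempty := by
    intro i _
    rcases h i with h | ⟨v, hv, s, hs, hvs⟩
    · simp only [Finset.mem_union, Finset.mem_filter, Finset.mem_univ, true_and]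
      exact Or.inl h
    · simp only [Finset.mem_union, Finset.mem_biUnion, Finset.mem_filter, Finset.mem_univ, true_and]
      exact Or.inr ⟨s, hs, v, hv, hvs⟩
  have h2 : (Finset.univ.filter fun i => ∃ v ∈ R i, v ∈ Y).card ≤ Y.card := by
    have : ∀ i, ∃ v, (∃ v ∈ R i, v ∈ Y) → v ∈ R i ∧ v ∈ Y := fun i => by
      by_cases h : ∃ v ∈ R i, v ∈ Y
      · obtain ⟨v, hv⟩ := h
        exact ⟨v, fun _ => hv⟩
      · by_cases h' : ∃ v : V, True
        · exact ⟨h'.choose, fun h'' => absurd h'' h⟩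
        · rcases ‹∀ i, (∃ v ∈ R i, v ∈ Y) ∨ ∃ v ∈ R i, ∃ s ∈ S, v ∈ C s› i with ⟨v, -⟩ | ⟨v, -⟩ <;>
            exact absurd ⟨v, trivial⟩ h'
    choose f hf using this
    refine Finset.card_le_card_of_injOn f (fun i hi => (hf i (Finset.mem_filter.1 hi).2).2) ?_
    intro i hi j hj hij
    by_contra hne
    refine Set.disjoint_left.1 (hR hne) (hf i (Finset.mem_filter.1 hi).2).1 ?_
    rw [hij]
    exact (hf j (Finset.mem_filter.1 hj).2).1
  have h3 := (Finset.card_le_card h1).trans (Finset.card_union_le _ _)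
  have h4 := Finset.card_biUnion_le (s := S)
    (t := fun s => Finset.univ.filter fun i => (R i ∩ C s).Nonempty)
  have h5 : ∀ s, (Finset.univ.filter fun i => (R i ∩ C s).Nonempty).card = hitCount R (C s) := by
    intro s
    rw [hitCount, ← Set.ncard_coe_finset]
    congr 1
    ext i
    simp
  simp only [h5] at h4
  rw [Finset.card_univ, Fintype.card_fin] at h3
  omega

end Layers

/-! ### Tight sets and the slicing of a link system. -/

section Slices

variable {V : Type u}

/-- A graph `G` with `q` disjoint paths `r i 0, …, r i (len i)` from `src` to `snk` and disjoint
connected sets `C p`, such that every edge of a path that is not inside one of the sets `C p` crosses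
a cut of order `q`. -/
structure LinkSystem (V : Type u) (q κ : ℕ) where
  G : SimpleGraph V
  src : Finset V
  snk : Finset V
  r : Fin q → ℕ → V
  len : Fin q → ℕ
  C : Fin κ → Finset V
  src_card : src.card ≤ q
  snk_card : snk.card ≤ q
  start_mem : ∀ i, r i 0 ∈ src
  end_mem : ∀ i, r i (len i) ∈ snk
  adj : ∀ i j, j < len i → G.Adj (r i j) (r i (j + 1))
  inj : ∀ i j i' j', j ≤ len i → j' ≤ len i' → r i j = r i' j' → i = i' ∧ j = j'
  C_disjoint : Pairwise fun p p' => Disjoint (C p) (C p')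
  C_conn : ∀ p (U : Set V), (∃ v ∈ C p, v ∈ U) → (∃ v ∈ C p, v ∉ U) →
    ∃ a ∈ C p, ∃ b ∈ C p, a ∈ U ∧ b ∉ U ∧ G.Adj a b
  critical : ∀ i j, j < len i → (∀ p, ¬ (r i j ∈ C p ∧ r i (j + 1) ∈ C p)) →
    ∃ U U' : Finset V, src ⊆ U ∧ (bdry G snk U).card ≤ q ∧ (bdry G snk U').card ≤ q ∧
      r i j ∈ U ∧ r i (j + 1) ∉ U ∧ ∀ v, v ∈ U' ↔ v = r i (j + 1) ∨ v ∈ U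

namespace LinkSystem

variable {q κ : ℕ} (Λ : LinkSystem V q κ)

/-- A vertex set containing the sources, with boundary of the minimum size `q`. -/
def Tight (U : Finset V) : Prop := Λ.src ⊆ U ∧ (bdry Λ.G Λ.snk U).card ≤ q

/-- The vertex set of the `i`-th path. -/
def path (i : Fin q) : Set V := {v | ∃ j ≤ Λ.len i, Λ.r i j = v}

variable {Λ}

theorem exists_mem_bdry {U : Finset V} {i : Fin q} {j : ℕ} (hj : j ≤ Λ.len i) (hU : Λ.r i j ∈ U) :
    ∃ j', j ≤ j' ∧ j' ≤ Λ.len i ∧ Λ.r i j' ∈ bdry Λ.G Λ.snk U := by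
  induction hn : Λ.len i - j generalizing j with
  | zero =>
    obtain rfl : j = Λ.len i := by omega
    exact ⟨_, le_rfl, le_rfl, mem_bdry.2 ⟨hU, Or.inl (Λ.end_mem i)⟩⟩
  | succ n ih =>
    by_cases h : Λ.r i (j + 1) ∈ U
    · obtain ⟨j', h1, h2, h3⟩ := ih (by omega) h (by omega)
      exact ⟨j', by omega, h2, h3⟩
    · exact ⟨j, le_rfl, hj, mem_bdry.2 ⟨hU, Or.inr ⟨_, h, Λ.adj i j (by omega)⟩⟩⟩

theorem card_le_of_meets {Y : Finset V} (h : ∀ i, ∃ j ≤ Λ.len i, Λ.r i j ∈ Y) : q ≤ Y.card := by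
  choose f hf hY using h
  have := Finset.card_le_card_of_injOn (s := Finset.univ) (fun i => Λ.r i (f i)) (fun i _ => hY i)
    (fun i _ i' _ h => (Λ.inj _ _ _ _ (hf i) (hf i') h).1)
  simpa using this

theorem le_card_bdry {U : Finset V} (hU : Λ.src ⊆ U) : q ≤ (bdry Λ.G Λ.snk U).card :=
  card_le_of_meets fun i => by
    obtain ⟨j, -, h⟩ := exists_mem_bdry (Nat.zero_le _) (hU (Λ.start_mem i))
    exact ⟨j, h⟩

/-- The boundary of a tight set has at most `q` vertices and meets all `q` disjoint paths, so it has
none to spare: two on one path would leave a transversal of size less than `q` after erasing one. -/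
theorem eq_of_mem_bdry {U : Finset V} (hU : Λ.Tight U) {i : Fin q} {j j' : ℕ}
    (hj : j ≤ Λ.len i) (hj' : j' ≤ Λ.len i) (h : Λ.r i j ∈ bdry Λ.G Λ.snk U)
    (h' : Λ.r i j' ∈ bdry Λ.G Λ.snk U) : j = j' := by
  classical
  by_contra hne
  have hcard : ((bdry Λ.G Λ.snk U).erase (Λ.r i j)).card < q :=
    lt_of_lt_of_le (Finset.card_erase_lt_of_mem h) hU.2
  refine absurd (card_le_of_meets (Λ := Λ) fun i' => ?_) (not_le.2 hcard)
  by_cases hi : i' = i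
  · subst hi
    exact ⟨j', hj', Finset.mem_erase.2 ⟨fun he => hne (Λ.inj _ _ _ _ hj' hj he).2.symm, h'⟩⟩
  · obtain ⟨k, -, hk, hkb⟩ := exists_mem_bdry (Nat.zero_le _) (hU.1 (Λ.start_mem i'))
    exact ⟨k, hk, Finset.mem_erase.2 ⟨fun he => hi (Λ.inj _ _ _ _ hk hj he).1, hkb⟩⟩

/-- A tight set meets every path in an initial segment. -/
theorem Tight.exists_prefix {U : Finset V} (hU : Λ.Tight U) (i : Fin q) :
    ∃ τ ≤ Λ.len i, ∀ j ≤ Λ.len i, Λ.r i j ∈ U ↔ j ≤ τ := by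
  obtain ⟨τ, -, hτ, hb⟩ := exists_mem_bdry (Nat.zero_le _) (hU.1 (Λ.start_mem i))
  refine ⟨τ, hτ, fun j hj => ⟨fun hjU => ?_, fun hjτ => ?_⟩⟩
  · obtain ⟨j', h1, h2, h3⟩ := exists_mem_bdry hj hjU
    exact h1.trans (eq_of_mem_bdry hU h2 hτ h3 hb).le
  · by_contra hjU
    have hex : ∃ m, Λ.r i m ∉ U := ⟨j, hjU⟩
    classical
    have hm := Nat.find_spec hex
    have hmj := Nat.find_min' hex hjU
    rcases hm0 : Nat.find hex with _ | m
    · rw [hm0] at hm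
      exact hm (hU.1 (Λ.start_mem i))
    · rw [hm0] at hm hmj
      have hmU : Λ.r i m ∈ U := by
        by_contra h
        have := Nat.find_min' hex h
        omega
      have hmb : Λ.r i m ∈ bdry Λ.G Λ.snk U :=
        mem_bdry.2 ⟨hmU, Or.inr ⟨_, hm, Λ.adj i m (by omega)⟩⟩
      have := eq_of_mem_bdry hU (by omega) hτ hmb hb
      omega

/-- Submodularity of the boundary size; together with the lower bound `q` it makes the tight sets a
lattice. -/
theorem bdry_inter_union [DecidableEq V] (G : SimpleGraph V) (T : Set V) (U W : Finset V) :
    (bdry G T (U ∩ W)).card + (bdry G T (U ∪ W)).card ≤ (bdry G T U).card + (bdry G T W).card := by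
  rw [← Finset.card_union_add_card_inter, ← Finset.card_union_add_card_inter (bdry G T U)]
  refine add_le_add (Finset.card_le_card ?_) (Finset.card_le_card ?_)
  · intro a ha
    simp only [Finset.mem_union, mem_bdry, Finset.mem_inter] at ha ⊢
    rcases ha with ⟨⟨h1, h2⟩, h3 | ⟨b, hb, hab⟩⟩ | ⟨h1, h3 | ⟨b, hb, hab⟩⟩
    · exact Or.inl ⟨h1, Or.inl h3⟩
    · by_cases hbU : b ∈ U
      · exact Or.inr ⟨h2, Or.inr ⟨b, fun h => hb ⟨hbU, h⟩, hab⟩⟩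
      · exact Or.inl ⟨h1, Or.inr ⟨b, hbU, hab⟩⟩
    · exact h1.imp (fun h => ⟨h, Or.inl h3⟩) fun h => ⟨h, Or.inl h3⟩
    · push Not at hb
      exact h1.imp (fun h => ⟨h, Or.inr ⟨b, hb.1, hab⟩⟩) fun h => ⟨h, Or.inr ⟨b, hb.2, hab⟩⟩
  · intro a ha
    simp only [Finset.mem_union, mem_bdry, Finset.mem_inter] at ha ⊢
    obtain ⟨⟨⟨h1, h2⟩, -⟩, -, h3 | ⟨b, hb, hab⟩⟩ := ha
    · exact ⟨⟨h1, Or.inl h3⟩, h2, Or.inl h3⟩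
    · push Not at hb
      exact ⟨⟨h1, Or.inr ⟨b, hb.1, hab⟩⟩, h2, Or.inr ⟨b, hb.2, hab⟩⟩

theorem Tight.inter [DecidableEq V] {U W : Finset V} (hU : Λ.Tight U) (hW : Λ.Tight W) :
    Λ.Tight (U ∩ W) := by
  refine ⟨Finset.subset_inter hU.1 hW.1, ?_⟩
  have h1 := bdry_inter_union Λ.G Λ.snk U W
  have h2 := le_card_bdry (Λ := Λ) (U := U ∪ W) (hU.1.trans Finset.subset_union_left)
  have h3 := hU.2
  have h4 := hW.2
  omega

theorem Tight.union [DecidableEq V] {U W : Finset V} (hU : Λ.Tight U) (hW : Λ.Tight W) :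
    Λ.Tight (U ∪ W) := by
  refine ⟨hU.1.trans Finset.subset_union_left, ?_⟩
  have h1 := bdry_inter_union Λ.G Λ.snk U W
  have h2 := le_card_bdry (Λ := Λ) (U := U ∩ W) (Finset.subset_inter hU.1 hW.1)
  have h3 := hU.2
  have h4 := hW.2
  omega

/-- Between consecutive tight sets there is no room for a set `C p` meeting two paths. -/
theorem not_between [DecidableEq V] {U U' : Finset V} (hU : Λ.Tight U) (hU' : Λ.Tight U')
    (hUU' : U ⊆ U') (hcons : ∀ W, Λ.Tight W → U ⊆ W → W ⊆ U' → W = U ∨ W = U') {p : Fin κ}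
    (hp : 2 ≤ hitCount Λ.path (Λ.C p)) (hpU' : Λ.C p ⊆ U') (hpU : Disjoint (Λ.C p) U) : False := by
  obtain ⟨i₁, h1, i₂, h2, hne⟩ := (Set.one_lt_ncard (Set.toFinite _)).1 (show 1 < _ from hp)
  obtain ⟨v₁, ⟨j₁, hj₁, rfl⟩, hv₁⟩ := h1
  obtain ⟨v₂, ⟨j₂, hj₂, rfl⟩, hv₂⟩ := h2
  have hex : ∃ j, Λ.r i₁ j ∈ Λ.C p := ⟨j₁, hv₁⟩
  have hm := Nat.find_spec hex
  have hmj := Nat.find_min' hex hv₁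
  have hmin := @Nat.find_min _ _ hex
  rcases hm0 : Nat.find hex with _ | m
  · rw [hm0] at hm
    exact Finset.disjoint_left.1 hpU hm (hU.1 (Λ.start_mem _))
  rw [hm0] at hm hmj hmin
  -- Let `y = r i₁ (m + 1)` be the first vertex of the path `i₁` in `C p`. The edge entering `y`
  -- lies in no set of the family, so criticality provides tight sets `W` and `W ∪ {y}`.
  obtain ⟨W, W', hsrc, hW, hW', -, hy, hWW'⟩ := Λ.critical i₁ m (by omega) fun p' ⟨h1, h2⟩ => by
    have : p' = p := by
      by_contra hne
      exact Finset.disjoint_left.1 (Λ.C_disjoint hne) h2 hm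
    subst this
    exact hmin (by omega) h1
  have hWT : Λ.Tight W := ⟨hsrc, hW⟩
  have hWT' : Λ.Tight W' := ⟨fun v hv => (hWW' v).2 (Or.inr (hsrc hv)), hW'⟩
  have hyU' := hpU' hm
  have hyU := Finset.disjoint_left.1 hpU hm
  -- Clipping both tight sets to the interval from `U` to `U'` gives tight sets again. The one
  -- omitting `y` must be `U` and the one containing `y` must be `U'`, which forces `C p ⊆ {y}`; but
  -- `C p` meets two disjoint paths.
  have e1 : W ∩ U' ∪ U = U := by
    refine (hcons _ ((hWT.inter hU').union hU) Finset.subset_union_right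
      (Finset.union_subset Finset.inter_subset_right hUU')).resolve_right fun he => ?_
    rw [← he, Finset.mem_union, Finset.mem_inter] at hyU'
    exact hyU'.elim (fun h => hy h.1) hyU
  have e2 : W' ∩ U' ∪ U = U' := by
    refine (hcons _ ((hWT'.inter hU').union hU) Finset.subset_union_right
      (Finset.union_subset Finset.inter_subset_right hUU')).resolve_left fun he => ?_
    apply hyU
    rw [← he]
    exact Finset.mem_union_left _ (Finset.mem_inter.2 ⟨(hWW' _).2 (Or.inl rfl), hyU'⟩)
  have hall : ∀ v ∈ Λ.C p, v = Λ.r i₁ (m + 1) := by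
    intro v hv
    have hvU := Finset.disjoint_left.1 hpU hv
    have hvU' := hpU' hv
    rw [← e2, Finset.mem_union, Finset.mem_inter] at hvU'
    have h3 := (hvU'.resolve_right hvU).1
    refine ((hWW' v).1 h3).resolve_right fun h => hvU ?_
    rw [← e1]
    exact Finset.mem_union_left _ (Finset.mem_inter.2 ⟨h, hpU' hv⟩)
  exact hne (Λ.inj _ _ _ _ (by omega) hj₂ ((hall _ hv₁).trans (hall _ hv₂).symm)).1

theorem card_meets_le [DecidableEq V] (D : Finset (Fin κ)) (Y : Finset V) :
    (D.filter fun p => ∃ v ∈ Λ.C p, v ∈ Y).card ≤ Y.card := by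
  have : ∀ p ∈ D.filter (fun p => ∃ v ∈ Λ.C p, v ∈ Y), ∃ v ∈ Λ.C p, v ∈ Y :=
    fun p hp => (Finset.mem_filter.1 hp).2
  rcases isEmpty_or_nonempty V with hV | hV
  · rw [Finset.filter_false_of_mem fun p _ ⟨v, _⟩ => hV.elim v]
    simp
  choose! f hf hY using this
  refine Finset.card_le_card_of_injOn f hY fun p hp p' hp' h => ?_
  by_contra hne
  exact Finset.disjoint_left.1 (Λ.C_disjoint hne) (hf p hp) (h ▸ hf p' hp')

theorem tight_univ [Fintype V] : Λ.Tight Finset.univ := by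
  refine ⟨Finset.subset_univ _, (Finset.card_le_card fun v hv => ?_).trans Λ.snk_card⟩
  simpa using (mem_bdry.1 hv).2

theorem tight_src : Λ.Tight Λ.src :=
  ⟨subset_rfl, (Finset.card_le_card fun _ hv => (mem_bdry.1 hv).1).trans Λ.src_card⟩

/-- Take `U'` smallest with `N` sets in its slice, and a maximal tight `W` between `U` and `U'`.
Fewer than `N` sets lie in `W`; by `not_between`, the other sets of the slice meet the boundary of
`W`, and sets straddling `U'` meet the boundary of `U'`. Both boundaries have at most `q` vertices,
whence the cost `N + 2 * q`. -/
theorem exists_next_tight [Fintype V] [DecidableEq V] {D : Finset (Fin κ)} {N : ℕ} (hN : 1 ≤ N)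
    (hD : ∀ p ∈ D, 2 ≤ hitCount Λ.path (Λ.C p)) {U : Finset V} (hU : Λ.Tight U)
    (hrem : N ≤ (D.filter fun p => Disjoint (Λ.C p) U).card) :
    ∃ U', Λ.Tight U' ∧ U ⊆ U' ∧ N ≤ (D.filter fun p => Λ.C p ⊆ U' ∧ Disjoint (Λ.C p) U).card ∧
      (D.filter fun p => Disjoint (Λ.C p) U).card ≤
        (D.filter fun p => Disjoint (Λ.C p) U').card + (N + 2 * q) := by
  have hex : ∃ m, ∃ U' : Finset V, U'.card = m ∧ Λ.Tight U' ∧ U ⊆ U' ∧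
      N ≤ (D.filter fun p => Λ.C p ⊆ U' ∧ Disjoint (Λ.C p) U).card :=
    ⟨_, Finset.univ, rfl, tight_univ, Finset.subset_univ _, by simpa using hrem⟩
  classical
  obtain ⟨U', hcard, hU', hUU', hN'⟩ := Nat.find_spec hex
  have hmin : ∀ W, Λ.Tight W → U ⊆ W → W ⊂ U' →
      (D.filter fun p => Λ.C p ⊆ W ∧ Disjoint (Λ.C p) U).card < N := by
    intro W hW hUW hWU'
    by_contra hlt
    exact Nat.find_min hex (hcard ▸ Finset.card_lt_card hWU') ⟨W, rfl, hW, hUW, not_lt.1 hlt⟩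
  have hne : U ≠ U' := by
    rintro rfl
    obtain ⟨p, hp⟩ := Finset.card_pos.1 (hN.trans hN')
    rw [Finset.mem_filter] at hp
    have h2 := hD p hp.1
    have hemp : Λ.C p = ∅ := by
      rw [← Finset.disjoint_self_iff_empty]
      exact hp.2.2.mono_right hp.2.1
    simp [hitCount, hemp] at h2
  obtain ⟨W, hWmem, hWmax⟩ := Finset.exists_max_image
    (Finset.univ.filter fun W => Λ.Tight W ∧ U ⊆ W ∧ W ⊂ U') Finset.card
    ⟨U, by simpa using ⟨hU, hUU'.ssubset_of_ne hne⟩⟩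
  simp only [Finset.mem_filter, Finset.mem_univ, true_and] at hWmem hWmax
  obtain ⟨hW, hUW, hWU'⟩ := hWmem
  have hcons : ∀ Z, Λ.Tight Z → W ⊆ Z → Z ⊆ U' → Z = W ∨ Z = U' := by
    intro Z hZ hWZ hZU'
    by_cases h : Z = U'
    · exact Or.inr h
    · exact Or.inl (Finset.eq_of_subset_of_card_le hWZ
        (hWmax Z ⟨hZ, hUW.trans hWZ, hZU'.ssubset_of_ne h⟩)).symm
  have h1 : (D.filter fun p => Λ.C p ⊆ U' ∧ Disjoint (Λ.C p) U) ⊆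
      (D.filter fun p => Λ.C p ⊆ W ∧ Disjoint (Λ.C p) U) ∪
      (D.filter fun p => ∃ v ∈ Λ.C p, v ∈ bdry Λ.G Λ.snk W) := by
    intro p hp
    rw [Finset.mem_filter] at hp
    rw [Finset.mem_union, Finset.mem_filter, Finset.mem_filter]
    by_cases hpW : Λ.C p ⊆ W
    · exact Or.inl ⟨hp.1, hpW, hp.2.2⟩
    · refine Or.inr ⟨hp.1, ?_⟩
      by_cases hdis : Disjoint (Λ.C p) W
      · exact (not_between hW hU' hWU'.1 hcons (hD p hp.1) hp.2.1 hdis).elim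
      · obtain ⟨a, ha, b, -, haW, hbW, hab⟩ := Λ.C_conn p (W : Set V)
          (by simpa [Finset.not_disjoint_iff] using hdis) (by simpa [Finset.not_subset] using hpW)
        exact ⟨a, ha, mem_bdry.2 ⟨by simpa using haW, Or.inr ⟨b, by simpa using hbW, hab⟩⟩⟩
  have h2 : (D.filter fun p => Disjoint (Λ.C p) U) ⊆
      (D.filter fun p => Disjoint (Λ.C p) U') ∪
      ((D.filter fun p => Λ.C p ⊆ U' ∧ Disjoint (Λ.C p) U) ∪
      (D.filter fun p => ∃ v ∈ Λ.C p, v ∈ bdry Λ.G Λ.snk U')) := by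
    intro p hp
    rw [Finset.mem_filter] at hp
    rw [Finset.mem_union, Finset.mem_union, Finset.mem_filter, Finset.mem_filter, Finset.mem_filter]
    by_cases hdis : Disjoint (Λ.C p) U'
    · exact Or.inl ⟨hp.1, hdis⟩
    by_cases hpU' : Λ.C p ⊆ U'
    · exact Or.inr (Or.inl ⟨hp.1, hpU', hp.2⟩)
    obtain ⟨a, ha, b, -, haW, hbW, hab⟩ := Λ.C_conn p (U' : Set V)
      (by simpa [Finset.not_disjoint_iff] using hdis) (by simpa [Finset.not_subset] using hpU')
    exact Or.inr (Or.inr ⟨hp.1, a, ha,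
      mem_bdry.2 ⟨by simpa using haW, Or.inr ⟨b, by simpa using hbW, hab⟩⟩⟩)
  refine ⟨U', hU', hUU', hN', ?_⟩
  have h3 := hmin W hW hUW hWU'
  have h4 := card_meets_le (Λ := Λ) D (bdry Λ.G Λ.snk W)
  have h5 := card_meets_le (Λ := Λ) D (bdry Λ.G Λ.snk U')
  have h6 := (Finset.card_le_card h1).trans (Finset.card_union_le _ _)
  have h7 := (Finset.card_le_card h2).trans (Finset.card_union_le _ _)
  have h8 := h7.trans (Nat.add_le_add_left (Finset.card_union_le _ _) _)
  have h9 := hW.2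
  have h10 := hU'.2
  omega

/-- There is a long increasing sequence of tight sets with many of the sets `C p`, `p ∈ D`, between
any two consecutive ones. -/
theorem exists_slices [Fintype V] [DecidableEq V] {D : Finset (Fin κ)} {N M : ℕ} (hN : 1 ≤ N)
    (hD : ∀ p ∈ D, 2 ≤ hitCount Λ.path (Λ.C p)) (hM : q + M * (N + 2 * q) ≤ D.card) :
    ∃ U : ℕ → Finset V, Monotone U ∧ (∀ k, Λ.Tight (U k)) ∧
      ∀ k < M, N ≤ (D.filter fun p => Λ.C p ⊆ U (k + 1) ∧ Disjoint (Λ.C p) (U k)).card := by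
  have hstep : ∀ U : Finset V, ∃ U', U ⊆ U' ∧ (Λ.Tight U → Λ.Tight U' ∧
      (N ≤ (D.filter fun p => Disjoint (Λ.C p) U).card →
        N ≤ (D.filter fun p => Λ.C p ⊆ U' ∧ Disjoint (Λ.C p) U).card) ∧
      (D.filter fun p => Disjoint (Λ.C p) U).card ≤
        (D.filter fun p => Disjoint (Λ.C p) U').card + (N + 2 * q)) := by
    intro U
    by_cases hU : Λ.Tight U
    · by_cases hrem : N ≤ (D.filter fun p => Disjoint (Λ.C p) U).card
      · obtain ⟨U', h1, h2, h3, h4⟩ := exists_next_tight hN hD hU hrem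
        exact ⟨U', h2, fun _ => ⟨h1, fun _ => h3, h4⟩⟩
      · exact ⟨U, subset_rfl, fun _ => ⟨hU, fun h => absurd h hrem, by omega⟩⟩
    · exact ⟨U, subset_rfl, fun h => absurd h hU⟩
  choose f hf hft using hstep
  let U : ℕ → Finset V := fun k => f^[k] Λ.src
  have hU : ∀ k, U (k + 1) = f (U k) := fun k => Function.iterate_succ_apply' _ _ _
  have htight : ∀ k, Λ.Tight (U k) := by
    intro k
    induction k with
    | zero => exact tight_src
    | succ k ih => rw [hU]; exact (hft _ ih).1
  -- The initial `q` pays for the sets that meet the sources; each slice then costs `N + 2 * q`.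
  have hrem : ∀ k, D.card ≤ (D.filter fun p => Disjoint (Λ.C p) (U k)).card +
      (q + k * (N + 2 * q)) := by
    intro k
    induction k with
    | zero =>
      have h1 : D ⊆ (D.filter fun p => Disjoint (Λ.C p) (U 0)) ∪
          D.filter fun p => ∃ v ∈ Λ.C p, v ∈ Λ.src := by
        intro p hp
        rw [Finset.mem_union, Finset.mem_filter, Finset.mem_filter]
        by_cases hdis : Disjoint (Λ.C p) (U 0)
        · exact Or.inl ⟨hp, hdis⟩
        · exact Or.inr ⟨hp, Finset.not_disjoint_iff.1 hdis⟩
      have h2 := (Finset.card_le_card h1).trans (Finset.card_union_le _ _)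
      have h3 := card_meets_le (Λ := Λ) D Λ.src
      have h4 := Λ.src_card
      omega
    | succ k ih =>
      have := (hft _ (htight k)).2.2
      rw [← hU] at this
      have e : (k + 1) * (N + 2 * q) = k * (N + 2 * q) + (N + 2 * q) := by ring
      omega
  refine ⟨U, monotone_nat_of_le_succ fun k => by rw [hU]; exact hf _, htight, fun k hk => ?_⟩
  have := (hft _ (htight k)).2.1
  rw [← hU] at this
  refine this ?_
  have h1 := hrem k
  have h2 : (k + 1) * (N + 2 * q) ≤ M * (N + 2 * q) := Nat.mul_le_mul_right _ hk
  have e : (k + 1) * (N + 2 * q) = k * (N + 2 * q) + (N + 2 * q) := by ring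
  omega

end LinkSystem

end Slices

/-! ### Link systems from edge-minimal subgraphs. -/

section Existence

variable {V : Type u}

/-- Adjacency is required only where the sequence leaves `U`, so the lemma still applies to a path
one of whose edges has been deleted, provided that this edge does not leave `U`. -/
theorem exists_mem_bdry_of_seq {G : SimpleGraph V} {T : Set V} {U : Finset V} {f : ℕ → V} {n : ℕ}
    (hadj : ∀ j < n, f j ∈ U → f (j + 1) ∉ U → G.Adj (f j) (f (j + 1))) (h0 : f 0 ∈ U)
    (hn : f n ∈ T) : ∃ j ≤ n, f j ∈ bdry G T U := by
  by_contra hcon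
  push Not at hcon
  have : ∀ j ≤ n, f j ∈ U := by
    intro j
    induction j with
    | zero => exact fun _ => h0
    | succ j ih =>
      intro hj
      by_contra h
      exact hcon j (by omega) (mem_bdry.2 ⟨ih (by omega), Or.inr ⟨_, h,
        hadj j (by omega) (ih (by omega)) h⟩⟩)
  exact hcon n le_rfl (mem_bdry.2 ⟨this n le_rfl, Or.inl hn⟩)

/-- A set-minimal subgraph among those that contain `F` and satisfy the cut condition. -/
theorem exists_minimal_subgraph [Fintype V] {H F : SimpleGraph V} (hF : F ≤ H) {S T : Set V} {q : ℕ}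
    (hcut : ∀ U : Finset V, S ⊆ U → q ≤ (bdry H T U).card) :
    ∃ G, F ≤ G ∧ G ≤ H ∧ (∀ U : Finset V, S ⊆ U → q ≤ (bdry G T U).card) ∧
      ∀ x y, G.Adj x y → ¬ F.Adj x y →
        ∃ U : Finset V, S ⊆ U ∧ (bdry (G.deleteEdges {s(x, y)}) T U).card < q := by
  classical
  have hex : ∃ m, ∃ G : SimpleGraph V, G.edgeSet.ncard = m ∧ F ≤ G ∧ G ≤ H ∧
      ∀ U : Finset V, S ⊆ U → q ≤ (bdry G T U).card := ⟨_, H, rfl, hF, le_rfl, hcut⟩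
  obtain ⟨G, hm, hFG, hGH, hG⟩ := Nat.find_spec hex
  refine ⟨G, hFG, hGH, hG, fun x y hxy hFxy => ?_⟩
  by_contra hcon
  push Not at hcon
  have hle : G.deleteEdges {s(x, y)} ≤ G := SimpleGraph.deleteEdges_le _
  refine Nat.find_min hex (m := (G.deleteEdges {s(x, y)}).edgeSet.ncard) ?_
    ⟨_, rfl, ?_, hle.trans hGH, hcon⟩
  · rw [← hm]
    apply Set.ncard_lt_ncard _ (Set.toFinite _)
    rw [SimpleGraph.edgeSet_ssubset_edgeSet]
    refine lt_of_le_of_ne hle fun he => ?_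
    have h1 := hxy
    rw [← he] at h1
    simp at h1
  · intro a b hab
    rw [SimpleGraph.deleteEdges_adj]
    refine ⟨hFG hab, fun he => ?_⟩
    rcases Sym2.eq_iff.1 (Set.mem_singleton_iff.1 he) with ⟨rfl, rfl⟩ | ⟨rfl, rfl⟩
    · exact hFxy hab
    · exact hFxy hab.symm

/-- The subgraph is minimal among those that contain all edges inside the sets `C p` and satisfy the
cut condition of order `q`. Deleting any other edge `xy` of a path makes some boundary smaller than
`q`. Restoring the edge adds at most one boundary vertex, `x` for the set `U` and `y` for `U ∪ {y}`,
so both sets are tight. -/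
theorem exists_linkSystem [Fintype V] {H : SimpleGraph V} {q κ : ℕ} {C : Fin κ → Finset V}
    (hC : Pairwise fun p p' => Disjoint (C p) (C p'))
    (hconn : ∀ p (U : Set V), (∃ v ∈ C p, v ∈ U) → (∃ v ∈ C p, v ∉ U) →
      ∃ a ∈ C p, ∃ b ∈ C p, a ∈ U ∧ b ∉ U ∧ H.Adj a b)
    {src snk : Finset V} (hsrc : src.card ≤ q) (hsnk : snk.card ≤ q)
    (h : HasDisjointPaths H src snk q) :
    ∃ Λ : LinkSystem V q κ, Λ.G ≤ H ∧ Λ.C = C ∧ Λ.src = src ∧ Λ.snk = snk := by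
  classical
  let F : SimpleGraph V :=
    { Adj := fun a b => H.Adj a b ∧ ∃ p, a ∈ C p ∧ b ∈ C p
      symm := ⟨fun _ _ ⟨h, p, ha, hb⟩ => ⟨h.symm, p, hb, ha⟩⟩
      loopless := ⟨fun _ h => h.1.ne rfl⟩ }
  obtain ⟨G, hFG, hGH, hcut, hmin⟩ := exists_minimal_subgraph (F := F) (H := H)
    (fun _ _ h => h.1) (fun U hU => h.le_card_bdry hU)
  obtain ⟨s, t, P, hs, ht, hP⟩ := menger G _ _ _ hcut
  have hadj : ∀ i j, j < (P i).1.length →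
      G.Adj ((P i).1.getVert j) ((P i).1.getVert (j + 1)) := fun i j hj =>
    (P i).1.adj_getVert_succ hj
  have hinj : ∀ i j i' j', j ≤ (P i).1.length → j' ≤ (P i').1.length →
      (P i).1.getVert j = (P i').1.getVert j' → i = i' ∧ j = j' := by
    intro i j i' j' hj hj' he
    by_cases hi : i = i'
    · subst hi
      exact ⟨rfl, (P i).2.getVert_injOn hj hj' he⟩
    · refine (hP hi ((P i).1.getVert_mem_support j) ?_).elim
      rw [he]
      exact (P i').1.getVert_mem_support j'
  refine ⟨⟨G, src, snk, fun i j => (P i).1.getVert j, fun i => (P i).1.length, C, hsrc, hsnk,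
    fun i => by simpa using hs i, fun i => by simpa using ht i, hadj, hinj, hC, ?_, ?_⟩,
    hGH, rfl, rfl, rfl⟩
  · intro p U h1 h2
    obtain ⟨a, ha, b, hb, haU, hbU, hab⟩ := hconn p U h1 h2
    exact ⟨a, ha, b, hb, haU, hbU, hFG ⟨hab, p, ha, hb⟩⟩
  · intro i j hj hp
    set x := (P i).1.getVert j with hx
    set y := (P i).1.getVert (j + 1) with hy
    have hxy : G.Adj x y := hadj i j hj
    obtain ⟨U, hSU, hU⟩ := hmin x y hxy fun hF => by
      obtain ⟨-, p, h1, h2⟩ := hF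
      exact hp p ⟨h1, h2⟩
    have hG' : ∀ a b, G.Adj a b → (G.deleteEdges {s(x, y)}).Adj a b ∨
        (a = x ∧ b = y) ∨ (a = y ∧ b = x) := by
      intro a b hab
      by_cases he : s(a, b) = s(x, y)
      · exact Or.inr (Sym2.eq_iff.1 he)
      · exact Or.inl (by rw [SimpleGraph.deleteEdges_adj]; exact ⟨hab, he⟩)
    -- If the path did not leave `U` along `xy`, all `q` disjoint paths would still meet the
    -- boundary after the deletion, which has fewer than `q` vertices.
    have hxyU : x ∈ U ∧ y ∉ U := by
      by_contra hcon
      have hmeet : ∀ i', ∃ j' ≤ (P i').1.length,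
          (P i').1.getVert j' ∈ bdry (G.deleteEdges {s(x, y)}) snk U := by
        intro i'
        refine exists_mem_bdry_of_seq (fun j' hj' hjU hjU' => ?_)
          (by simpa using hSU (hs i')) (by simpa using ht i')
        rcases hG' _ _ (hadj i' j' hj') with h | ⟨h, h'⟩ | ⟨h, h'⟩
        · exact h
        · exact absurd ⟨h ▸ hjU, h' ▸ hjU'⟩ hcon
        · have h1 := (hinj _ _ _ _ hj'.le (show j + 1 ≤ (P i).1.length by omega) h)
          have h2 := (hinj _ _ _ _ (show j' + 1 ≤ (P i').1.length by omega) hj.le h')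
          omega
      choose f hf hfU using hmeet
      have := Finset.card_le_card_of_injOn (s := Finset.univ) (fun i => (P i).1.getVert (f i))
        (fun i _ => hfU i) (fun i _ i' _ h => (hinj _ _ _ _ (hf i) (hf i') h).1)
      simp only [Finset.card_univ, Fintype.card_fin] at this
      omega
    refine ⟨U, insert y U, by simpa using hSU, ?_, ?_, hxyU.1, hxyU.2, by simp⟩
    · have hsub : bdry G snk U ⊆ insert x (bdry (G.deleteEdges {s(x, y)}) snk U) := by
        intro a ha
        obtain ⟨haU, haT | ⟨b, hb, hab⟩⟩ := mem_bdry.1 ha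
        · exact Finset.mem_insert_of_mem (mem_bdry.2 ⟨haU, Or.inl haT⟩)
        · rcases hG' a b hab with h1 | ⟨h1, h2⟩ | ⟨h1, h2⟩
          · exact Finset.mem_insert_of_mem (mem_bdry.2 ⟨haU, Or.inr ⟨b, hb, h1⟩⟩)
          · exact h1 ▸ Finset.mem_insert_self _ _
          · exact absurd (h1 ▸ haU) hxyU.2
      have := (Finset.card_le_card hsub).trans (Finset.card_insert_le _ _)
      omega
    · have hsub : bdry G snk (insert y U) ⊆
          insert y (bdry (G.deleteEdges {s(x, y)}) snk U) := by
        intro a ha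
        obtain ⟨haU, ha⟩ := mem_bdry.1 ha
        rcases Finset.mem_insert.1 haU with rfl | haU
        · exact Finset.mem_insert_self _ _
        refine Finset.mem_insert_of_mem (mem_bdry.2 ⟨haU, ?_⟩)
        rcases ha with haT | ⟨b, hb, hab⟩
        · exact Or.inl haT
        · rw [Finset.mem_insert, not_or] at hb
          rcases hG' a b hab with h1 | ⟨h1, h2⟩ | ⟨h1, h2⟩
          · exact Or.inr ⟨b, hb.2, h1⟩
          · exact absurd h2 hb.1
          · exact absurd (h1 ▸ haU) hxyU.2
      have := (Finset.card_le_card hsub).trans (Finset.card_insert_le _ _)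
      omega

end Existence

/-! ### Robustly connected subgraphs of dense bipartite graphs. -/

section Robust

variable {ι τ : Type*} [DecidableEq ι] [DecidableEq τ]

open Classical in
/-- The pairs in `S × T` related by `rel`. -/
noncomputable def relPairs (rel : τ → ι → Prop) (S : Finset ι) (T : Finset τ) : Finset (ι × τ) :=
  (S ×ˢ T).filter fun x => rel x.2 x.1

open Classical in
theorem card_relPairs_erase_left (rel : τ → ι → Prop) (S : Finset ι) (T : Finset τ) (i : ι) :
    (relPairs rel S T).card ≤
      (relPairs rel (S.erase i) T).card + (T.filter fun p => rel p i).card := by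
  rw [← Finset.card_image_of_injective (T.filter fun p => rel p i) (Prod.mk_right_injective i)]
  refine (Finset.card_le_card ?_).trans (Finset.card_union_le _ _)
  rintro ⟨j, p⟩ h
  simp only [relPairs, Finset.mem_filter, Finset.mem_product, Finset.mem_union, Finset.mem_erase,
    Finset.mem_image, Prod.mk.injEq] at h ⊢
  by_cases hj : j = i
  · subst hj
    exact Or.inr ⟨p, ⟨h.1.2, h.2⟩, rfl, rfl⟩
  · exact Or.inl ⟨⟨⟨hj, h.1.1⟩, h.1.2⟩, h.2⟩

open Classical in
theorem card_relPairs_erase_right (rel : τ → ι → Prop) (S : Finset ι) (T : Finset τ) (p : τ) :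
    (relPairs rel S T).card ≤
      (relPairs rel S (T.erase p)).card + (S.filter fun i => rel p i).card := by
  rw [← Finset.card_image_of_injective (S.filter fun i => rel p i) (Prod.mk_left_injective p)]
  refine (Finset.card_le_card ?_).trans (Finset.card_union_le _ _)
  rintro ⟨j, p'⟩ h
  simp only [relPairs, Finset.mem_filter, Finset.mem_product, Finset.mem_union, Finset.mem_erase,
    Finset.mem_image, Prod.mk.injEq] at h ⊢
  by_cases hj : p' = p
  · subst hj
    exact Or.inr ⟨j, ⟨h.1.1, h.2⟩, rfl, rfl⟩
  · exact Or.inl ⟨⟨h.1.1, hj, h.1.2⟩, h.2⟩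

open Classical in
-- The two parts overlap only in `L`.
theorem card_filter_add_card_filter_not_le (Z L : Finset ι) {ψ ψ' : ι → Prop} {c : ℕ}
    (hL : L.card ≤ c) (hψ : ∀ i, ψ' i ↔ ¬ ψ i) : (Z.filter fun i => i ∈ L ∨ ψ i).card +
      (Z.filter fun i => i ∈ L ∨ ψ' i).card ≤ Z.card + c := by
  rw [← Finset.card_union_add_card_inter]
  refine add_le_add (Finset.card_le_card ?_) ((Finset.card_le_card ?_).trans hL)
  · exact Finset.union_subset (Finset.filter_subset _ _) (Finset.filter_subset _ _)
  · intro i hi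
    simp only [Finset.mem_inter, Finset.mem_filter, hψ] at hi
    tauto

open Classical in
/-- A bipartite graph of large weighted density has a subgraph of large minimum degrees which stays
connected after the deletion of `c` vertices on each side. -/
theorem exists_robust_subpair (rel : τ → ι → Prop) {S₀ : Finset ι} {T₀ : Finset τ} {α b c : ℕ}
    (hc : 0 < c) (hα : 4 * c ≤ α) (hb : 4 * c ≤ b) (hS₀ : 2 * c ≤ S₀.card) (hT₀ : 2 * c ≤ T₀.card)
    (hf : α * S₀.card + b * T₀.card < (relPairs rel S₀ T₀).card + (α + b) * c) :
    ∃ S ⊆ S₀, ∃ T ⊆ T₀, S.Nonempty ∧ T.Nonempty ∧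
      (∀ i ∈ S, α < (T.filter fun p => rel p i).card) ∧
      (∀ p ∈ T, b < (S.filter fun i => rel p i).card) ∧
      ∀ (K : Finset ι) (K' : Finset τ) (χ : ι → Prop) (χ' : τ → Prop), K.card ≤ c → K'.card ≤ c →
        (∀ i ∈ S, i ∉ K → ∀ p ∈ T, p ∉ K' → rel p i → (χ i ↔ χ' p)) →
        (∀ i ∈ S, i ∉ K → χ i) ∨ ∀ i ∈ S, i ∉ K → ¬ χ i := by
  -- Goodness says that the weight `e(S,T) - α|S| - b|T| + (α + b)c` is positive, and a smallest
  -- good pair is taken. Deleting a vertex of low degree does not lower the weight, and the last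
  -- term pays for counting `K` and `K'` on both sides of a separation.
  let Good : Finset ι → Finset τ → Prop := fun S T => S ⊆ S₀ ∧ T ⊆ T₀ ∧ 2 * c ≤ S.card ∧
    2 * c ≤ T.card ∧ α * S.card + b * T.card < (relPairs rel S T).card + (α + b) * c
  have hex : ∃ m, ∃ S T, S.card + T.card = m ∧ Good S T :=
    ⟨_, S₀, T₀, rfl, subset_rfl, subset_rfl, hS₀, hT₀, hf⟩
  obtain ⟨S, T, hm, hSS₀, hTT₀, hS2, hT2, hST⟩ := Nat.find_spec hex
  have hmin : ∀ S' T', S'.card + T'.card < S.card + T.card → ¬ Good S' T' :=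
    fun S' T' hlt h => Nat.find_min hex (hm ▸ hlt) ⟨S', T', rfl, h⟩
  have hle : (relPairs rel S T).card ≤ S.card * T.card := by
    rw [← Finset.card_product]
    exact Finset.card_le_card (Finset.filter_subset _ _)
  -- The floor is never attained: with `|S| = 2c` there are at most `2c|T|` edges, too few for
  -- positive weight. This leaves room to delete a vertex.
  have hS : 2 * c < S.card := by
    refine lt_of_le_of_ne hS2 fun he => ?_
    rw [← he] at hle hST
    nlinarith [Nat.mul_le_mul hb hT2, Nat.mul_le_mul_right T.card hb,
      Nat.mul_le_mul_right c hα, Nat.mul_le_mul_left b hT2, Nat.mul_le_mul_right c hb]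
  have hT : 2 * c < T.card := by
    refine lt_of_le_of_ne hT2 fun he => ?_
    rw [← he] at hle hST
    nlinarith [Nat.mul_le_mul hα hS2, Nat.mul_le_mul_right S.card hα,
      Nat.mul_le_mul_right c hb, Nat.mul_le_mul_left α hS2, Nat.mul_le_mul_right c hα]
  have hdegS : ∀ i ∈ S, α < (T.filter fun p => rel p i).card := by
    intro i hi
    by_contra hlt
    have h1 := card_relPairs_erase_left rel S T i
    have h2 := Finset.card_erase_add_one hi
    refine hmin (S.erase i) T (by omega)
      ⟨(Finset.erase_subset _ _).trans hSS₀, hTT₀, by omega, hT2, ?_⟩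
    rw [← h2, mul_add, mul_one] at hST
    omega
  have hdegT : ∀ p ∈ T, b < (S.filter fun i => rel p i).card := by
    intro p hp
    by_contra hlt
    have h1 := card_relPairs_erase_right rel S T p
    have h2 := Finset.card_erase_add_one hp
    refine hmin S (T.erase p) (by omega)
      ⟨hSS₀, (Finset.erase_subset _ _).trans hTT₀, hS2, by omega, ?_⟩
    rw [← h2, mul_add b, mul_one] at hST
    omega
  refine ⟨S, hSS₀, T, hTT₀, Finset.card_pos.1 (by omega), Finset.card_pos.1 (by omega), hdegS,
    hdegT, ?_⟩
  intro K K' χ χ' hK hK' hχ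
  by_contra hcon
  push Not at hcon
  obtain ⟨⟨i₂, hi₂, hi₂K, hχ₂⟩, i₁, hi₁, hi₁K, hχ₁⟩ := hcon
  -- Either side of a separation, with `K` and `K'` added, still has more than `4c` vertices of both
  -- kinds, because degrees exceed `α` and `b`. It is smaller than the minimal pair, so its weight
  -- is not positive; adding the two sides contradicts the goodness of `(S, T)`.
  have hpart : ∀ (χ : ι → Prop) (χ' : τ → Prop) (i j : ι), i ∈ S → i ∉ K → χ i → j ∈ S → j ∉ K →
      ¬ χ j → (∀ i ∈ S, i ∉ K → ∀ p ∈ T, p ∉ K' → rel p i → (χ i ↔ χ' p)) →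
      (relPairs rel (S.filter fun i => i ∈ K ∨ χ i) (T.filter fun p => p ∈ K' ∨ χ' p)).card +
        (α + b) * c ≤ α * (S.filter fun i => i ∈ K ∨ χ i).card +
          b * (T.filter fun p => p ∈ K' ∨ χ' p).card := by
    intro χ χ' i j hi hiK hχi hj hjK hχj hχ
    have h1 : 4 * c < (T.filter fun p => p ∈ K' ∨ χ' p).card := by
      refine lt_of_le_of_lt hα (lt_of_lt_of_le (hdegS i hi) (Finset.card_le_card fun p hp => ?_))
      rw [Finset.mem_filter] at hp ⊢
      refine ⟨hp.1, ?_⟩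
      by_cases hpK : p ∈ K'
      · exact Or.inl hpK
      · exact Or.inr ((hχ i hi hiK p hp.1 hpK hp.2).1 hχi)
    obtain ⟨p, hp, hpK⟩ : ∃ p ∈ T.filter (fun p => p ∈ K' ∨ χ' p), p ∉ K' := by
      by_contra hcon
      push Not at hcon
      have := Finset.card_le_card (show T.filter (fun p => p ∈ K' ∨ χ' p) ⊆ K' from hcon)
      omega
    rw [Finset.mem_filter] at hp
    have h2 : 4 * c < (S.filter fun i => i ∈ K ∨ χ i).card := by
      refine lt_of_le_of_lt hb (lt_of_lt_of_le (hdegT p hp.1) (Finset.card_le_card fun i hi => ?_))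
      rw [Finset.mem_filter] at hi ⊢
      refine ⟨hi.1, ?_⟩
      by_cases hiK : i ∈ K
      · exact Or.inl hiK
      · exact Or.inr ((hχ i hi.1 hiK p hp.1 hpK hi.2).2 (hp.2.resolve_left hpK))
    by_contra hlt
    refine hmin _ _ ?_ ⟨(Finset.filter_subset _ _).trans hSS₀, (Finset.filter_subset _ _).trans hTT₀,
      by omega, by omega, not_le.1 hlt⟩
    refine add_lt_add_of_lt_of_le (Finset.card_lt_card ?_)
      (Finset.card_le_card (Finset.filter_subset _ _))
    refine ⟨Finset.filter_subset _ _, fun h => ?_⟩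
    have := (Finset.mem_filter.1 (h hj)).2
    tauto
  have hp1 := hpart χ χ' i₁ i₂ hi₁ hi₁K hχ₁ hi₂ hi₂K hχ₂ hχ
  obtain ⟨ν, hν⟩ : ∃ ν : ι → Prop, ∀ i, ν i ↔ ¬ χ i := ⟨_, fun _ => Iff.rfl⟩
  obtain ⟨ν', hν'⟩ : ∃ ν' : τ → Prop, ∀ p, ν' p ↔ ¬ χ' p := ⟨_, fun _ => Iff.rfl⟩
  have hp2 := hpart ν ν' i₂ i₁ hi₂ hi₂K ((hν _).2 hχ₂) hi₁ hi₁K (fun h => (hν _).1 h hχ₁)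
    fun i hi hiK p hp hpK hr => by rw [hν, hν', hχ i hi hiK p hp hpK hr]
  have hs1 := card_filter_add_card_filter_not_le S K hK hν
  have hs2 := card_filter_add_card_filter_not_le T K' hK' hν'
  have he : (relPairs rel S T).card ≤
      (relPairs rel (S.filter fun i => i ∈ K ∨ χ i) (T.filter fun p => p ∈ K' ∨ χ' p)).card +
      (relPairs rel (S.filter fun i => i ∈ K ∨ ν i)
        (T.filter fun p => p ∈ K' ∨ ν' p)).card := by
    refine (Finset.card_le_card ?_).trans (Finset.card_union_le _ _)
    rintro ⟨i, p⟩ h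
    simp only [relPairs, Finset.mem_filter, Finset.mem_product, Finset.mem_union] at h ⊢
    rw [hν, hν']
    by_cases hiK : i ∈ K
    · by_cases hp : χ' p
      · exact Or.inl ⟨⟨⟨h.1.1, Or.inl hiK⟩, h.1.2, Or.inr hp⟩, h.2⟩
      · exact Or.inr ⟨⟨⟨h.1.1, Or.inl hiK⟩, h.1.2, Or.inr hp⟩, h.2⟩
    by_cases hpK : p ∈ K'
    · by_cases hi : χ i
      · exact Or.inl ⟨⟨⟨h.1.1, Or.inr hi⟩, h.1.2, Or.inl hpK⟩, h.2⟩
      · exact Or.inr ⟨⟨⟨h.1.1, Or.inr hi⟩, h.1.2, Or.inl hpK⟩, h.2⟩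
    have h3 := hχ i h.1.1 hiK p h.1.2 hpK h.2
    by_cases hi : χ i
    · exact Or.inl ⟨⟨⟨h.1.1, Or.inr hi⟩, h.1.2, Or.inr (h3.1 hi)⟩, h.2⟩
    · exact Or.inr ⟨⟨⟨h.1.1, Or.inr hi⟩, h.1.2, Or.inr fun hp => hi (h3.2 hp)⟩, h.2⟩
  have m1 := Nat.mul_le_mul_left α hs1
  have m2 := Nat.mul_le_mul_left b hs2
  rw [mul_add, mul_add] at m1 m2
  rw [add_mul] at hp1 hp2 hST
  omega

end Robust

/-! ### Set families with small overlaps, and chains of related indices. -/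

section Families

/-- If every subfamily of at least two sets splits into two parts with small intersection, then the
family is small compared to its union. -/
theorem card_mul_le_of_split {ι κ : Type*} [DecidableEq ι] [DecidableEq κ] (S : κ → Finset ι)
    {s d : ℕ} (F : Finset κ) (hF : F.Nonempty) (hs : ∀ k ∈ F, s ≤ (S k).card)
    (hsplit : ∀ F' ⊆ F, 2 ≤ F'.card → ∃ F₁ F₂ : Finset κ, F₁.Nonempty ∧ F₂.Nonempty ∧
      Disjoint F₁ F₂ ∧ F₁ ∪ F₂ = F' ∧ (F₁.biUnion S ∩ F₂.biUnion S).card ≤ d) :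
    F.card * s + d ≤ (F.biUnion S).card + F.card * d := by
  induction hn : F.card using Nat.strong_induction_on generalizing F with
  | _ n ih =>
  subst hn
  by_cases h2 : 2 ≤ F.card
  -- Splitting down to single sets takes `|F| - 1` steps, and inclusion–exclusion loses at most `d`
  -- in each.
  · obtain ⟨F₁, F₂, hF₁, hF₂, hdis, hun, hd⟩ := hsplit F subset_rfl h2
    have hcard := Finset.card_union_of_disjoint hdis
    have hp1 := hF₁.card_pos
    have hp2 := hF₂.card_pos
    have hs1 : F₁ ⊆ F := hun ▸ Finset.subset_union_left
    have hs2 : F₂ ⊆ F := hun ▸ Finset.subset_union_right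
    rw [hun] at hcard
    have h1 := ih F₁.card (by omega) F₁ hF₁ (fun k hk => hs k (hs1 hk))
      (fun F' h => hsplit F' (h.trans hs1)) rfl
    have h2 := ih F₂.card (by omega) F₂ hF₂ (fun k hk => hs k (hs2 hk))
      (fun F' h => hsplit F' (h.trans hs2)) rfl
    have h3 := Finset.card_union_add_card_inter (F₁.biUnion S) (F₂.biUnion S)
    rw [← Finset.union_biUnion, hun] at h3
    rw [hcard, add_mul, add_mul]
    omega
  · have h1 : F.card = 1 := by have := hF.card_pos; omega
    obtain ⟨k, rfl⟩ := Finset.card_eq_one.1 h1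
    simpa using hs k (by simp)

/-- There is a sequence of `n + 1` consecutively related numbers ending at `k`. -/
def HasChain (rel : ℕ → ℕ → Prop) : ℕ → ℕ → Prop
  | 0, _ => True
  | n + 1, k => ∃ a < k, rel a k ∧ HasChain rel n a

theorem HasChain.exists_seq {rel : ℕ → ℕ → Prop} {n k : ℕ} (h : HasChain rel n k) :
    ∃ φ : ℕ → ℕ, φ n = k ∧ ∀ j < n, φ j < φ (j + 1) ∧ rel (φ j) (φ (j + 1)) := by
  induction n generalizing k with
  | zero => exact ⟨fun _ => k, rfl, by simp⟩
  | succ n ih =>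
    obtain ⟨a, hak, hrel, ha⟩ := h
    obtain ⟨φ, hφ, hφ'⟩ := ih ha
    refine ⟨fun j => if j = n + 1 then k else φ j, by simp, fun j hj => ?_⟩
    rcases Nat.lt_succ_iff_lt_or_eq.1 hj with hj | rfl
    · simpa [show j ≠ n + 1 by omega, show j ≠ n by omega] using hφ' j hj
    · simpa [hφ] using ⟨hak, hrel⟩

/-- Either there is a long chain for a relation compatible with the order, or a large set without
related pairs. -/
theorem exists_chain {rel : ℕ → ℕ → Prop} {M m ℓ : ℕ}
    (hrel : ∀ F ⊆ Finset.range M, (∀ a ∈ F, ∀ b ∈ F, a < b → ¬ rel a b) → F.card ≤ m)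
    (hM : ℓ * m < M) :
    ∃ φ : ℕ → ℕ, (∀ j ≤ ℓ, φ j < M) ∧ ∀ j < ℓ, φ j < φ (j + 1) ∧ rel (φ j) (φ (j + 1)) := by
  classical
  by_cases h : ∃ k < M, HasChain rel ℓ k
  · obtain ⟨k, hk, hc⟩ := h
    obtain ⟨φ, hφ, hφ'⟩ := hc.exists_seq
    refine ⟨φ, fun j hj => lt_of_le_of_lt ?_ hk, hφ'⟩
    rw [← hφ]
    induction hd : ℓ - j generalizing j with
    | zero => rw [show j = ℓ by omega]
    | succ d ih =>
      exact (hφ' j (by omega)).1.le.trans (ih (j + 1) (by omega) (by omega))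
  · push Not at h
    exfalso
    -- The level of `k` is the length of a longest chain ending at `k`, capped at `ℓ`. Related
    -- indices have different levels, so each level has at most `m` elements; transitivity is not
    -- needed.
    let lev : ℕ → ℕ := fun k => Nat.findGreatest (fun n => HasChain rel n k) ℓ
    have hspec : ∀ k, HasChain rel (lev k) k := fun k =>
      Nat.findGreatest_spec (P := fun n => HasChain rel n k) (Nat.zero_le ℓ) trivial
    have hlt : ∀ k < M, lev k < ℓ := fun k hk => by
      refine lt_of_le_of_ne (Nat.findGreatest_le ℓ) fun he => h k hk ?_
      have := hspec k
      rwa [he] at this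
    obtain ⟨y, -, hy⟩ := Finset.exists_lt_card_fiber_of_mul_lt_card_of_maps_to
      (s := Finset.range M) (t := Finset.range ℓ) (f := lev) (n := m)
      (fun k hk => Finset.mem_range.2 (hlt k (Finset.mem_range.1 hk))) (by simpa using hM)
    refine absurd (hrel _ (Finset.filter_subset _ _) fun a ha b hb hab hr => ?_) (not_le.2 hy)
    rw [Finset.mem_filter, Finset.mem_range] at ha hb
    have h1 : HasChain rel (lev a + 1) b := ⟨a, hab, hr, hspec a⟩
    have h2 : lev a + 1 ≤ lev b := Nat.le_findGreatest (hlt a ha.1) h1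
    omega

open Classical in
theorem mul_le_card_relPairs {ι τ : Type*} [DecidableEq ι] [DecidableEq τ] (rel : τ → ι → Prop)
    (S : Finset ι) (T : Finset τ) {h : ℕ} (hh : ∀ p ∈ T, h ≤ (S.filter fun i => rel p i).card) :
    T.card * h ≤ (relPairs rel S T).card := by
  rw [Finset.card_eq_sum_card_fiberwise (f := Prod.snd) (t := T)
    (fun x hx => by simp [relPairs] at hx; exact hx.1.2)]
  rw [← smul_eq_mul]
  refine Finset.card_nsmul_le_sum _ _ _ fun p hp => (hh p hp).trans ?_
  refine Finset.card_le_card_of_injOn (fun i => (i, p)) (fun i hi => ?_)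
    (fun i _ j _ h => (Prod.mk.inj h).1)
  rw [Finset.mem_coe, Finset.mem_filter] at hi
  rw [Finset.mem_coe, Finset.mem_filter, relPairs, Finset.mem_filter, Finset.mem_product]
  exact ⟨⟨⟨hi.1, hp⟩, hi.2⟩, rfl⟩

end Families

/-! ### One robust cluster in each slice. -/

section Clusters

variable {V : Type u}

/-- In each of `M` consecutive slices, a set `S k` of segments of paths and a set `T k` of connected
sets whose contact graph stays connected after the deletion of `w` elements of each kind. -/
structure ClusterSystem {q κ : ℕ} (Λ : LinkSystem V q κ) (M w s : ℕ) where
  U : ℕ → Finset V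
  mono : Monotone U
  τ : ℕ → Fin q → ℕ
  τ_le : ∀ k i, τ k i ≤ Λ.len i
  mem_U : ∀ k i j, j ≤ Λ.len i → (Λ.r i j ∈ U k ↔ j ≤ τ k i)
  S : ℕ → Finset (Fin q)
  T : ℕ → Finset (Fin κ)
  card_S : ∀ k < M, s ≤ (S k).card
  T_sub : ∀ k < M, ∀ p ∈ T k, Λ.C p ⊆ U (k + 1) ∧ Disjoint (Λ.C p) (U k)
  seg_len : ∀ k < M, ∀ i ∈ S k, τ k i + 2 ≤ τ (k + 1) i
  hit : ∀ k < M, ∀ p ∈ T k, ∃ i ∈ S k, (Λ.path i ∩ Λ.C p).Nonempty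
  robust : ∀ k < M, ∀ (K : Finset (Fin q)) (K' : Finset (Fin κ)) (χ : Fin q → Prop)
    (χ' : Fin κ → Prop), K.card ≤ w → K'.card ≤ w →
    (∀ i ∈ S k, i ∉ K → ∀ p ∈ T k, p ∉ K' → (Λ.path i ∩ Λ.C p).Nonempty → (χ i ↔ χ' p)) →
    (∀ i ∈ S k, i ∉ K → χ i) ∨ ∀ i ∈ S k, i ∉ K → ¬ χ i

/-- A slice provides `N` sets meeting at least `h` paths each. Half of these `N * h` incidences pays
for `α * q`, the other half for `b * N`, which is the density required by `exists_robust_subpair`.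
-/
theorem exists_clusterSystem [Fintype V] {q κ : ℕ} {Λ : LinkSystem V q κ} {D : Finset (Fin κ)}
    {N M h w α b : ℕ} (hw : 0 < w) (hα : 4 * w ≤ α) (hb : 4 * w ≤ b) (hq : 2 * w ≤ q)
    (hN : 2 * w ≤ N) (hαN : 2 * (α * q) ≤ N * h) (hbh : 2 * b ≤ h)
    (hD : ∀ p ∈ D, h ≤ hitCount Λ.path (Λ.C p)) (hM : q + M * (N + 2 * q) ≤ D.card) :
    Nonempty (ClusterSystem Λ M w b) := by
  classical
  obtain ⟨U, hmono, htight, hslice⟩ := LinkSystem.exists_slices (Λ := Λ) (D := D) (N := N) (M := M)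
    (by omega) (fun p hp => le_trans (by omega) (hD p hp)) hM
  choose τ hτ hτU using fun k i => (htight k).exists_prefix i
  have hcl : ∀ k, ∃ (S : Finset (Fin q)) (T : Finset (Fin κ)), k < M →
      (∀ p ∈ T, Λ.C p ⊆ U (k + 1) ∧ Disjoint (Λ.C p) (U k)) ∧ T.Nonempty ∧
      (∀ i ∈ S, α < (T.filter fun p => (Λ.path i ∩ Λ.C p).Nonempty).card) ∧
      (∀ p ∈ T, b < (S.filter fun i => (Λ.path i ∩ Λ.C p).Nonempty).card) ∧
      ∀ (K : Finset (Fin q)) (K' : Finset (Fin κ)) (χ : Fin q → Prop)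
        (χ' : Fin κ → Prop), K.card ≤ w → K'.card ≤ w →
        (∀ i ∈ S, i ∉ K → ∀ p ∈ T, p ∉ K' → (Λ.path i ∩ Λ.C p).Nonempty → (χ i ↔ χ' p)) →
        (∀ i ∈ S, i ∉ K → χ i) ∨ ∀ i ∈ S, i ∉ K → ¬ χ i := by
    intro k
    by_cases hk : k < M
    swap
    · exact ⟨∅, ∅, fun h => absurd h hk⟩
    obtain ⟨T₀, hT₀, hT₀N⟩ := Finset.exists_subset_card_eq (hslice k hk)
    have hpairs := mul_le_card_relPairs (fun p i => (Λ.path i ∩ (Λ.C p : Set V)).Nonempty)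
      (Finset.univ : Finset (Fin q)) T₀ (h := h) fun p hp => by
        refine (hD p (Finset.mem_filter.1 (hT₀ hp)).1).trans (le_of_eq ?_)
        rw [hitCount, ← Set.ncard_coe_finset]
        congr 1
        ext i
        simp
    have hpos : 0 < (α + b) * w := Nat.mul_pos (by omega) hw
    obtain ⟨S, -, T, hT, -, hTne, h1, h2, h3⟩ := exists_robust_subpair
      (fun p i => (Λ.path i ∩ (Λ.C p : Set V)).Nonempty) (S₀ := Finset.univ) (T₀ := T₀) hw hα hb
      (by simpa using hq) (by omega) (by
        rw [hT₀N] at hpairs ⊢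
        rw [Finset.card_univ, Fintype.card_fin]
        have : b * N * 2 ≤ N * h := by nlinarith
        omega)
    exact ⟨S, T, fun _ => ⟨fun p hp => (Finset.mem_filter.1 (hT₀ (hT hp))).2, hTne, h1, h2, h3⟩⟩
  choose S T hST using hcl
  refine ⟨⟨U, hmono, τ, hτ, hτU, S, T, fun k hk => ?_, fun k hk => (hST k hk).1,
    fun k hk i hi => ?_, fun k hk p hp => ?_, fun k hk => (hST k hk).2.2.2.2⟩⟩
  · obtain ⟨p, hp⟩ := (hST k hk).2.1
    exact ((hST k hk).2.2.2.1 p hp).le.trans (Finset.card_le_card (Finset.filter_subset _ _))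
  -- The path meets two disjoint sets of the slice, hence has two vertices there. Consequently left
  -- and right ends of a cluster never coincide.
  · have h1 := (hST k hk).2.2.1 i hi
    obtain ⟨p₁, hp₁, p₂, hp₂, hne⟩ := Finset.one_lt_card.1 (show 1 < _ from lt_of_le_of_lt (by omega) h1)
    rw [Finset.mem_filter] at hp₁ hp₂
    have hpos : ∀ p ∈ T k, ∀ j ≤ Λ.len i, Λ.r i j ∈ Λ.C p → τ k i < j ∧ j ≤ τ (k + 1) i := by
      intro p hp j hj hjp
      obtain ⟨h2, h3⟩ := (hST k hk).1 p hp
      refine ⟨?_, (hτU _ i j hj).1 (h2 hjp)⟩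
      by_contra hlt
      exact Finset.disjoint_left.1 h3 hjp ((hτU _ i j hj).2 (not_lt.1 hlt))
    obtain ⟨hp₁, -, ⟨j₁, hj₁, rfl⟩, hj₁p⟩ := hp₁
    obtain ⟨hp₂, -, ⟨j₂, hj₂, rfl⟩, hj₂p⟩ := hp₂
    have h2 := hpos p₁ hp₁ j₁ hj₁ hj₁p
    have h3 := hpos p₂ hp₂ j₂ hj₂ hj₂p
    have : j₁ ≠ j₂ := by
      rintro rfl
      exact Finset.disjoint_left.1 (Λ.C_disjoint hne) hj₁p hj₂p
    omega
  · obtain ⟨i, hi⟩ := Finset.card_pos.1 (lt_of_le_of_lt (Nat.zero_le _) ((hST k hk).2.2.2.1 p hp))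
    rw [Finset.mem_filter] at hi
    exact ⟨i, hi.1, hi.2⟩

end Clusters

/-! ### Linkages within a cluster and between clusters. -/

section ClusterLinks

variable {V : Type u} {q κ : ℕ} {Λ : LinkSystem V q κ}

namespace LinkSystem

theorem card_filter_meets_le {g : Fin q → Set V} (hg : ∀ i, g i ⊆ Λ.path i) (Y : Finset V)
    [DecidablePred fun i => ∃ v ∈ g i, v ∈ Y] :
    (Finset.univ.filter fun i => ∃ v ∈ g i, v ∈ Y).card ≤ Y.card := by
  have : ∀ i ∈ Finset.univ.filter (fun i => ∃ v ∈ g i, v ∈ Y), ∃ v ∈ g i, v ∈ Y :=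
    fun i hi => (Finset.mem_filter.1 hi).2
  rcases isEmpty_or_nonempty V with hV | hV
  · rw [Finset.filter_false_of_mem fun p _ ⟨v, _⟩ => hV.elim v]
    simp
  choose! f hf hY using this
  refine Finset.card_le_card_of_injOn f hY fun i hi i' hi' h => ?_
  obtain ⟨j, hj, he⟩ := hg i (hf i hi)
  obtain ⟨j', hj', he'⟩ := hg i' (hf i' hi')
  exact (Λ.inj _ _ _ _ hj hj' (he.trans (h.trans he'.symm))).1

/-- A segment of a path avoiding the boundary of a set is inside or outside of the set. -/
theorem segment_mono {W Uc : Set V} {bd : Finset V}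
    (hcut : ∀ a ∈ W, ∀ b ∈ W, a ∈ Uc → b ∉ Uc → Λ.G.Adj a b → a ∈ bd) {i : Fin q} {l u : ℕ}
    (hu : u ≤ Λ.len i) (hW : ∀ j, l ≤ j → j ≤ u → Λ.r i j ∈ W)
    (hbd : ∀ j, l ≤ j → j ≤ u → Λ.r i j ∉ bd) {j j' : ℕ} (hj : l ≤ j) (hju : j ≤ u) (hj' : l ≤ j')
    (hju' : j' ≤ u) : Λ.r i j ∈ Uc ↔ Λ.r i j' ∈ Uc := by
  have key : ∀ n, l + n ≤ u → (Λ.r i l ∈ Uc ↔ Λ.r i (l + n) ∈ Uc) := by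
    intro n
    induction n with
    | zero => simp
    | succ n ih =>
      intro hn
      rw [ih (by omega)]
      have hadj := Λ.adj i (l + n) (by omega)
      constructor
      · intro h
        by_contra h'
        exact hbd (l + n) (by omega) (by omega)
          (hcut _ (hW _ (by omega) (by omega)) _ (hW _ (by omega) (by omega)) h h' hadj)
      · intro h
        by_contra h'
        exact hbd (l + n + 1) (by omega) (by omega)
          (hcut _ (hW _ (by omega) (by omega)) _ (hW _ (by omega) (by omega)) h h' hadj.symm)
  have h1 := key (j - l) (by omega)
  have h2 := key (j' - l) (by omega)
  rw [show l + (j - l) = j by omega] at h1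
  rw [show l + (j' - l) = j' by omega] at h2
  rw [← h1, h2]

theorem set_mono {W Uc : Set V} {bd : Finset V}
    (hcut : ∀ a ∈ W, ∀ b ∈ W, a ∈ Uc → b ∉ Uc → Λ.G.Adj a b → a ∈ bd) {p : Fin κ}
    (hW : ∀ v ∈ Λ.C p, v ∈ W) (hbd : ∀ v ∈ Λ.C p, v ∉ bd) {x : V} (hx : x ∈ Λ.C p) (hxU : x ∈ Uc) :
    ∀ v ∈ Λ.C p, v ∈ Uc := by
  by_contra hcon
  push Not at hcon
  obtain ⟨a, ha, b, hb, haU, hbU, hab⟩ := Λ.C_conn p Uc ⟨x, hx, hxU⟩ hcon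
  exact hbd a ha (hcut a (hW a ha) b (hW b hb) haU hbU hab)

end LinkSystem

namespace ClusterSystem

variable {M w s : ℕ} (Γ : ClusterSystem Λ M w s)

/-- The part of the `i`-th path inside the `k`-th slice. -/
def seg (k : ℕ) (i : Fin q) : Set V := {v | ∃ j, Γ.τ k i < j ∧ j ≤ Γ.τ (k + 1) i ∧ Λ.r i j = v}

/-- The vertex set of the `k`-th cluster. -/
def Z (k : ℕ) : Set V := {v | (∃ i ∈ Γ.S k, v ∈ Γ.seg k i) ∨ ∃ p ∈ Γ.T k, v ∈ Λ.C p}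

variable {Γ}

theorem seg_subset_path (k : ℕ) (i : Fin q) : Γ.seg k i ⊆ Λ.path i :=
  fun _ ⟨j, _, h2, h3⟩ => ⟨j, h2.trans (Γ.τ_le _ _), h3⟩

theorem eq_of_mem_seg {k k' : ℕ} {i i' : Fin q} {v : V} (h : v ∈ Γ.seg k i)
    (h' : v ∈ Γ.seg k' i') : i = i' := by
  obtain ⟨j, hj, rfl⟩ := seg_subset_path k i h
  obtain ⟨j', hj', he⟩ := seg_subset_path k' i' h'
  exact (Λ.inj _ _ _ _ hj hj' he.symm).1

theorem mem_slice_of_mem_seg {k : ℕ} {i : Fin q} {v : V} (h : v ∈ Γ.seg k i) :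
    v ∈ Γ.U (k + 1) ∧ v ∉ Γ.U k := by
  obtain ⟨j, h1, h2, rfl⟩ := h
  have hj := h2.trans (Γ.τ_le _ _)
  exact ⟨(Γ.mem_U _ _ _ hj).2 h2, fun h => not_le.2 h1 ((Γ.mem_U _ _ _ hj).1 h)⟩

theorem mem_slice {k : ℕ} (hk : k < M) {v : V} (h : v ∈ Γ.Z k) : v ∈ Γ.U (k + 1) ∧ v ∉ Γ.U k := by
  rcases h with ⟨i, -, h⟩ | ⟨p, hp, h⟩
  · exact mem_slice_of_mem_seg h
  · obtain ⟨h1, h2⟩ := Γ.T_sub k hk p hp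
    exact ⟨h1 h, Finset.disjoint_left.1 h2 h⟩

theorem mem_seg_of_mem_path {k : ℕ} {i : Fin q} {v : V} (hv : v ∈ Λ.path i)
    (h : v ∈ Γ.U (k + 1) ∧ v ∉ Γ.U k) : v ∈ Γ.seg k i := by
  obtain ⟨j, hj, rfl⟩ := hv
  refine ⟨j, ?_, (Γ.mem_U _ _ _ hj).1 h.1, rfl⟩
  by_contra hlt
  exact h.2 ((Γ.mem_U _ _ _ hj).2 (not_lt.1 hlt))

theorem seg_mono {W Uc : Set V} {bd : Finset V}
    (hcut : ∀ a ∈ W, ∀ b ∈ W, a ∈ Uc → b ∉ Uc → Λ.G.Adj a b → a ∈ bd) {k : ℕ} {i : Fin q}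
    (hW : Γ.seg k i ⊆ W) (hbd : ∀ v ∈ Γ.seg k i, v ∉ bd) {x : V} (hx : x ∈ Γ.seg k i)
    (hxU : x ∈ Uc) : ∀ v ∈ Γ.seg k i, v ∈ Uc := by
  obtain ⟨j, h1, h2, rfl⟩ := hx
  rintro _ ⟨j', h1', h2', rfl⟩
  exact (LinkSystem.segment_mono hcut (l := Γ.τ k i + 1) (Γ.τ_le (k + 1) i)
    (fun j h h' => hW ⟨j, h, h', rfl⟩) (fun j h h' => hbd _ ⟨j, h, h', rfl⟩) h1 h2 h1' h2').1 hxU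

theorem seg_subset_Z {k : ℕ} {i : Fin q} (hi : i ∈ Γ.S k) : Γ.seg k i ⊆ Γ.Z k :=
  fun _ hv => Or.inl ⟨i, hi, hv⟩

/-- A set with at most `w` boundary vertices does not separate the segments of a cluster which avoid
these vertices. -/
theorem monochromatic {k : ℕ} (hk : k < M) {W Uc : Set V} {bd : Finset V}
    (hcut : ∀ a ∈ W, ∀ b ∈ W, a ∈ Uc → b ∉ Uc → Λ.G.Adj a b → a ∈ bd) (hZ : Γ.Z k ⊆ W)
    (hw : bd.card ≤ w) :
    (∀ i ∈ Γ.S k, (∀ v ∈ Γ.seg k i, v ∉ bd) → ∀ v ∈ Γ.seg k i, v ∈ Uc) ∨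
      ∀ i ∈ Γ.S k, (∀ v ∈ Γ.seg k i, v ∉ bd) → ∀ v ∈ Γ.seg k i, v ∉ Uc := by
  classical
  -- The segments and sets meeting `bd` play the role of deleted vertices. Each of the others lies
  -- on one side of `Uc`, and those that intersect lie on the same side.
  have hrob := Γ.robust k hk (Finset.univ.filter fun i => ∃ v ∈ Γ.seg k i, v ∈ bd)
    (Finset.univ.filter fun p => ∃ v ∈ Λ.C p, v ∈ bd)
    (fun i => ∀ v ∈ Γ.seg k i, v ∈ Uc) (fun p => ∀ v ∈ Λ.C p, v ∈ Uc)
    ((LinkSystem.card_filter_meets_le (seg_subset_path k) bd).trans hw)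
    ((LinkSystem.card_meets_le _ bd).trans hw)
  refine (hrob ?_).imp (fun h i hi hbd => h i hi (by simpa using hbd))
    fun h i hi hbd v hv hvU => h i hi (by simpa using hbd)
      (seg_mono hcut ((seg_subset_Z hi).trans hZ) hbd hv hvU)
  · intro i hi hiK p hp hpK hip
    simp only [Finset.mem_filter, Finset.mem_univ, true_and, not_exists, not_and] at hiK hpK
    obtain ⟨v, hvi, hvp⟩ := hip
    have hvs : v ∈ Γ.seg k i := mem_seg_of_mem_path hvi (mem_slice hk (Or.inr ⟨p, hp, hvp⟩))
    constructor
    · intro h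
      exact LinkSystem.set_mono hcut (fun v hv => hZ (Or.inr ⟨p, hp, hv⟩)) hpK hvp (h v hvs)
    · intro h
      exact seg_mono hcut ((seg_subset_Z hi).trans hZ) hiK hvs (h v hvp)

/-- The elements of `T` are on distinct disjoint segments, more in number than the vertices of `bd`.
-/
theorem exists_seg_avoiding [Finite V] {k m : ℕ} {T : Set V}
    (hT : ∀ t ∈ T, ∃ i ∈ Γ.S k, t ∈ Γ.seg k i)
    (hinj : ∀ i, ∀ t ∈ T, ∀ t' ∈ T, t ∈ Γ.seg k i → t' ∈ Γ.seg k i → t = t') (hm : m ≤ T.ncard)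
    {bd : Finset V} (hbd : bd.card < m) :
    ∃ t ∈ T, ∃ i ∈ Γ.S k, t ∈ Γ.seg k i ∧ ∀ v ∈ Γ.seg k i, v ∉ bd := by
  by_contra hcon
  push Not at hcon
  obtain ⟨t₀, ht₀⟩ : T.Nonempty := Set.nonempty_of_ncard_ne_zero (by omega)
  have : Nonempty (Fin q) := ⟨(hT t₀ ht₀).choose⟩
  have : Nonempty V := ⟨t₀⟩
  choose! ι hι hιt using hT
  have : ∀ t ∈ T, ∃ v ∈ Γ.seg k (ι t), v ∈ bd := fun t ht => hcon t ht _ (hι t ht) (hιt t ht)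
  choose! f hf hfbd using this
  have h1 : T.ncard ≤ (bd : Set V).ncard := by
    refine Set.ncard_le_ncard_of_injOn f hfbd (fun t ht t' ht' he => ?_) (Set.toFinite _)
    have he' : ι t = ι t' := eq_of_mem_seg (hf t ht) (he ▸ hf t' ht')
    exact hinj (ι t) t ht t' ht' (hιt t ht) (he' ▸ hιt t' ht')
  rw [Set.ncard_coe_finset] at h1
  omega

/-- Sets of vertices of a cluster on distinct segments are linked inside the cluster. -/
theorem hasDisjointPaths_cluster [Fintype V] {k m : ℕ} (hk : k < M) (hmw : m ≤ w) {T₁ T₂ : Set V}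
    (h₁ : ∀ t ∈ T₁, ∃ i ∈ Γ.S k, t ∈ Γ.seg k i)
    (hinj₁ : ∀ i, ∀ t ∈ T₁, ∀ t' ∈ T₁, t ∈ Γ.seg k i → t' ∈ Γ.seg k i → t = t')
    (h₂ : ∀ t ∈ T₂, ∃ i ∈ Γ.S k, t ∈ Γ.seg k i)
    (hinj₂ : ∀ i, ∀ t ∈ T₂, ∀ t' ∈ T₂, t ∈ Γ.seg k i → t' ∈ Γ.seg k i → t = t')
    (hm₁ : m ≤ T₁.ncard) (hm₂ : m ≤ T₂.ncard) :
    HasDisjointPaths (within Λ.G (Γ.Z k)) T₁ T₂ m := by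
  refine menger _ _ _ _ fun U hU => ?_
  by_contra hlt
  rw [not_le] at hlt
  set bd := bdry (within Λ.G (Γ.Z k)) T₂ U with hbd
  obtain ⟨t₁, ht₁, i₁, hi₁, hts₁, hav₁⟩ := exists_seg_avoiding h₁ hinj₁ hm₁ hlt
  obtain ⟨t₂, ht₂, i₂, hi₂, hts₂, hav₂⟩ := exists_seg_avoiding h₂ hinj₂ hm₂ hlt
  -- Both segments avoid the cut, so they are on the same side of `U`. But `t₁` is in `U`, and if
  -- `t₂` were too, it would be a boundary vertex.
  rcases monochromatic (Γ := Γ) hk (W := Γ.Z k) (Uc := U) (bd := bd)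
    (fun a ha b hb haU hbU hab =>
      mem_bdry.2 ⟨by simpa using haU, Or.inr ⟨b, by simpa using hbU, hab, ha, hb⟩⟩) subset_rfl
    (by omega) with h | h
  · exact hav₂ t₂ hts₂ (mem_bdry.2 ⟨h i₂ hi₂ hav₂ t₂ hts₂, Or.inl ht₂⟩)
  · exact h i₁ hi₁ hav₁ t₁ hts₁ (hU ht₁)

theorem seg_nonempty {k : ℕ} (hk : k < M) {i : Fin q} (hi : i ∈ Γ.S k) : (Γ.seg k i).Nonempty := by
  have := Γ.seg_len k hk i hi
  exact ⟨_, Γ.τ k i + 1, by omega, by omega, rfl⟩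

/-- This is `monochromatic` with an empty boundary, extended to the sets of `T k`, each of which
touches a segment. -/
theorem cluster_connected {k : ℕ} (hk : k < M) {Uc : Set V}
    (hcl : ∀ a ∈ Γ.Z k, ∀ b ∈ Γ.Z k, a ∈ Uc → Λ.G.Adj a b → b ∈ Uc) {x : V} (hx : x ∈ Γ.Z k)
    (hxU : x ∈ Uc) : ∀ v ∈ Γ.Z k, v ∈ Uc := by
  have hcut : ∀ a ∈ Γ.Z k, ∀ b ∈ Γ.Z k, a ∈ Uc → b ∉ Uc → Λ.G.Adj a b → a ∈ (∅ : Finset V) :=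
    fun a ha b hb haU hbU hab => absurd (hcl a ha b hb haU hab) hbU
  have hhit : ∀ p ∈ Γ.T k, ∃ i ∈ Γ.S k, ∃ v ∈ Γ.seg k i, v ∈ Λ.C p := by
    intro p hp
    obtain ⟨i, hi, v, hvi, hvp⟩ := Γ.hit k hk p hp
    exact ⟨i, hi, v, mem_seg_of_mem_path hvi (mem_slice hk (Or.inr ⟨p, hp, hvp⟩)), hvp⟩
  have hset : ∀ p ∈ Γ.T k, ∀ y ∈ Λ.C p, y ∈ Uc → ∀ v ∈ Λ.C p, v ∈ Uc := fun p hp y hy hyU =>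
    LinkSystem.set_mono hcut (fun v hv => Or.inr ⟨p, hp, hv⟩) (by simp) hy hyU
  rcases monochromatic (Γ := Γ) hk hcut subset_rfl (by simp) with h | h
  · rintro v (⟨i, hi, hv⟩ | ⟨p, hp, hv⟩)
    · exact h i hi (by simp) v hv
    · obtain ⟨i, hi, y, hy, hyp⟩ := hhit p hp
      exact hset p hp y hyp (h i hi (by simp) y hy) v hv
  · exfalso
    rcases hx with ⟨i, hi, hv⟩ | ⟨p, hp, hv⟩
    · exact h i hi (by simp) x hv hxU
    · obtain ⟨i, hi, y, hy, hyp⟩ := hhit p hp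
      exact h i hi (by simp) y hy (hset p hp x hv hxU y hyp)

variable (Γ)

/-- The last vertices of the segments of the `k`-th cluster. -/
def rightEnds (k : ℕ) : Set V := {v | ∃ i ∈ Γ.S k, v = Λ.r i (Γ.τ (k + 1) i)}

/-- The first vertices of the segments of the `k`-th cluster. -/
def leftEnds (k : ℕ) : Set V := {v | ∃ i ∈ Γ.S k, v = Λ.r i (Γ.τ k i + 1)}

/-- The region strictly between two clusters, with the ends of the segments of these clusters. -/
def between (a b : ℕ) : Set V :=
  {v | v ∈ Γ.rightEnds a ∨ v ∈ Γ.leftEnds b ∨ v ∈ Γ.U b ∧ v ∉ Γ.U (a + 1)}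

/-- The existence of `w` disjoint paths between two clusters. -/
def Linked (a b : ℕ) : Prop :=
  HasDisjointPaths (within Λ.G (Γ.between a b)) (Γ.rightEnds a) (Γ.leftEnds b) w

variable {Γ}

theorem τ_mono (i : Fin q) {a b : ℕ} (hab : a ≤ b) : Γ.τ a i ≤ Γ.τ b i :=
  (Γ.mem_U _ _ _ (Γ.τ_le a i)).1 (Γ.mono hab ((Γ.mem_U _ _ _ (Γ.τ_le a i)).2 le_rfl))

/-- If the first and the last cluster of a family are not linked then the family splits into two
parts with few common paths. -/
theorem exists_split [Fintype V] {F : Finset ℕ} {a b : ℕ} (hF : ∀ k ∈ F, k < M) (ha : a ∈ F)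
    (hb : b ∈ F) (hab : a < b) (hmin : ∀ k ∈ F, a ≤ k) (hmax : ∀ k ∈ F, k ≤ b)
    (hlink : ¬ Γ.Linked a b) : ∃ F₁ F₂ : Finset ℕ, F₁.Nonempty ∧ F₂.Nonempty ∧
      Disjoint F₁ F₂ ∧ F₁ ∪ F₂ = F ∧ (F₁.biUnion Γ.S ∩ F₂.biUnion Γ.S).card ≤ w := by
  classical
  obtain ⟨U', hU', hlt⟩ : ∃ U' : Finset V, Γ.rightEnds a ⊆ U' ∧
      (bdry (within Λ.G (Γ.between a b)) (Γ.leftEnds b) U').card < w := by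
    by_contra hcon
    push Not at hcon
    exact hlink (menger _ _ _ _ hcon)
  set bd := bdry (within Λ.G (Γ.between a b)) (Γ.leftEnds b) U' with hbd
  have hcut : ∀ x ∈ Γ.between a b, ∀ y ∈ Γ.between a b, x ∈ (U' : Set V) → y ∉ (U' : Set V) →
      Λ.G.Adj x y → x ∈ bd := fun x hx y hy hxU hyU hxy =>
    mem_bdry.2 ⟨by simpa using hxU, Or.inr ⟨y, by simpa using hyU, hxy, hx, hy⟩⟩
  -- `lo i` and `hi i` delimit the section of the path `i` in the region between the clusters. The
  -- end in cluster `a` or `b` is included only if the path belongs to that cluster, for only then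
  -- is that vertex guaranteed to be in the region.
  let lo : Fin q → ℕ := fun i => if i ∈ Γ.S a then Γ.τ (a + 1) i else Γ.τ (a + 1) i + 1
  let hi : Fin q → ℕ := fun i => if i ∈ Γ.S b then Γ.τ b i + 1 else Γ.τ b i
  have hhi : ∀ i, hi i ≤ Λ.len i := by
    intro i
    by_cases h : i ∈ Γ.S b
    · have h1 := Γ.seg_len b (hF b hb) i h
      have h2 := Γ.τ_le (b + 1) i
      simp only [hi, if_pos h]
      omega
    · simpa only [hi, if_neg h] using Γ.τ_le b i
  have hlo : ∀ i, Γ.τ (a + 1) i ≤ lo i ∧ lo i ≤ Γ.τ (a + 1) i + 1 := by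
    intro i; simp only [lo]; split_ifs <;> omega
  have hhi' : ∀ i, Γ.τ b i ≤ hi i ∧ hi i ≤ Γ.τ b i + 1 := by
    intro i; simp only [hi]; split_ifs <;> omega
  have hreg : ∀ i j, lo i ≤ j → j ≤ hi i → Λ.r i j ∈ Γ.between a b := by
    intro i j h1 h2
    have hj := h2.trans (hhi i)
    by_cases e1 : j ≤ Γ.τ (a + 1) i
    · by_cases hia : i ∈ Γ.S a
      · exact Or.inl ⟨i, hia, by rw [le_antisymm e1 ((hlo i).1.trans h1)]⟩
      · simp only [lo, if_neg hia] at h1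
        omega
    by_cases e2 : Γ.τ b i < j
    · by_cases hib : i ∈ Γ.S b
      · exact Or.inr (Or.inl ⟨i, hib, by rw [show j = Γ.τ b i + 1 by have := (hhi' i).2; omega]⟩)
      · simp only [hi, if_neg hib] at h2
        omega
    exact Or.inr (Or.inr ⟨(Γ.mem_U _ _ _ hj).2 (not_lt.1 e2),
      fun h => e1 ((Γ.mem_U _ _ _ hj).1 h)⟩)
  let g : Fin q → Set V := fun i => {v | ∃ j, lo i ≤ j ∧ j ≤ hi i ∧ Λ.r i j = v}
  let K : Finset (Fin q) := Finset.univ.filter fun i => ∃ v ∈ g i, v ∈ bd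
  have hg : ∀ i, g i ⊆ Λ.path i := fun i v hv => by
    obtain ⟨j, -, h2, h3⟩ := hv
    exact ⟨j, h2.trans (hhi i), h3⟩
  have hK : K.card ≤ w := (LinkSystem.card_filter_meets_le hg bd).trans hlt.le
  have hKbd : ∀ i ∉ K, ∀ j, lo i ≤ j → j ≤ hi i → Λ.r i j ∉ bd := by
    intro i hiK j h1 h2 hb
    exact hiK (Finset.mem_filter.2 ⟨Finset.mem_univ _, _, ⟨j, h1, h2, rfl⟩, hb⟩)
  have hmono : ∀ i ∉ K, ∀ j j', lo i ≤ j → j ≤ hi i → lo i ≤ j' → j' ≤ hi i →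
      Λ.r i j ∈ U' → Λ.r i j' ∈ U' := by
    intro i hiK j j' h1 h2 h3 h4 h
    simpa using (LinkSystem.segment_mono hcut (hhi i) (hreg i) (hKbd i hiK) h1 h2 h3 h4).1
      (by simpa using h)
  have hsegpos : ∀ k, a < k → k < b → ∀ i j, Γ.τ k i < j → j ≤ Γ.τ (k + 1) i →
      lo i ≤ j ∧ j ≤ hi i := by
    intro k hak hkb i j h1 h2
    have h3 := τ_mono (Γ := Γ) i (show a + 1 ≤ k from hak)
    have h4 := τ_mono (Γ := Γ) i (show k + 1 ≤ b from hkb)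
    have h5 := hlo i
    have h6 := hhi' i
    omega
  -- The parts are the clusters on the source side of the cut and the rest. A path used by both
  -- parts has to be cut: otherwise its whole section is in `U'`, whereas a cluster of the second
  -- part forces it to end in a boundary vertex or to have a segment outside `U'`.
  let Red : ℕ → Prop := fun k => k = a ∨ k ≠ b ∧
    ∀ i ∈ Γ.S k, i ∉ K → ∀ j, lo i ≤ j → j ≤ hi i → Λ.r i j ∈ U'
  refine ⟨F.filter Red, F.filter fun k => ¬ Red k,
    ⟨a, Finset.mem_filter.2 ⟨ha, Or.inl rfl⟩⟩, ⟨b, Finset.mem_filter.2 ⟨hb, fun h => ?_⟩⟩,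
    Finset.disjoint_filter_filter_not _ _ _, Finset.filter_union_filter_not_eq _ _,
    (Finset.card_le_card fun i hi' => ?_).trans hK⟩
  · rcases h with h | h
    · exact hab.ne' h
    · exact h.1 rfl
  by_contra hiK
  rw [Finset.mem_inter, Finset.mem_biUnion, Finset.mem_biUnion] at hi'
  obtain ⟨⟨k₁, hk₁, hik₁⟩, k₂, hk₂, hik₂⟩ := hi'
  rw [Finset.mem_filter] at hk₁ hk₂
  -- A section may be empty for a path outside both extreme clusters; here such a path has a segment
  -- in the cluster `k₁` strictly between them.
  have hlohi : lo i ≤ hi i := by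
    rcases Nat.lt_or_ge (Γ.τ (a + 1) i) (Γ.τ b i) with h | h
    · have h5 := hlo i
      have h6 := hhi' i
      omega
    · have h0 := τ_mono (Γ := Γ) i (show a + 1 ≤ b from hab)
      have h5 := hlo i
      have h6 := hhi' i
      by_cases hia : i ∈ Γ.S a
      · have : lo i = Γ.τ (a + 1) i := if_pos hia
        omega
      by_cases hib : i ∈ Γ.S b
      · have : hi i = Γ.τ b i + 1 := if_pos hib
        omega
      have hk1a : k₁ ≠ a := fun h => hia (h ▸ hik₁)
      have hk1b : k₁ ≠ b := fun h => hib (h ▸ hik₁)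
      have h7 := hmin _ hk₁.1
      have h8 := hmax _ hk₁.1
      have h9 := Γ.seg_len k₁ (hF _ hk₁.1) i hik₁
      have h10 := τ_mono (Γ := Γ) i (show a + 1 ≤ k₁ by omega)
      have h11 := τ_mono (Γ := Γ) i (show k₁ + 1 ≤ b by omega)
      omega
  have hred : ∀ j, lo i ≤ j → j ≤ hi i → Λ.r i j ∈ U' := by
    rcases hk₁.2 with rfl | h
    · have e : lo i = Γ.τ (k₁ + 1) i := if_pos hik₁
      have h1 : Λ.r i (lo i) ∈ U' := hU' ⟨i, hik₁, by rw [e]⟩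
      intro j h2 h3
      exact hmono i hiK _ _ le_rfl hlohi h2 h3 h1
    · exact h.2 i hik₁ hiK
  have hk₂a : k₂ ≠ a := fun h => hk₂.2 (Or.inl h)
  by_cases hk₂b : k₂ = b
  · subst hk₂b
    have e : hi i = Γ.τ k₂ i + 1 := if_pos hik₂
    refine hKbd i hiK (hi i) hlohi le_rfl (mem_bdry.2 ⟨hred _ hlohi le_rfl, Or.inl ⟨i, hik₂, ?_⟩⟩)
    rw [e]
  have hak : a < k₂ := lt_of_le_of_ne (hmin _ hk₂.1) (Ne.symm hk₂a)
  have hkb : k₂ < b := lt_of_le_of_ne (hmax _ hk₂.1) hk₂b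
  have hZ : Γ.Z k₂ ⊆ Γ.between a b := fun v hv => by
    obtain ⟨h1, h2⟩ := mem_slice (hF _ hk₂.1) hv
    exact Or.inr (Or.inr ⟨Γ.mono hkb h1, fun h => h2 (Γ.mono hak h)⟩)
  have hav : ∀ i ∉ K, ∀ v ∈ Γ.seg k₂ i, v ∉ bd := by
    rintro i hiK _ ⟨j, h1, h2, rfl⟩
    obtain ⟨h3, h4⟩ := hsegpos k₂ hak hkb i j h1 h2
    exact hKbd i hiK j h3 h4
  rcases monochromatic (Γ := Γ) (hF _ hk₂.1) hcut hZ hlt.le with h | h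
  · refine hk₂.2 (Or.inr ⟨hk₂b, fun i' hi' hiK' j h1 h2 => ?_⟩)
    obtain ⟨_, ⟨j', h3, h4, rfl⟩⟩ := seg_nonempty (Γ := Γ) (hF _ hk₂.1) hi'
    have h5 := h i' hi' (hav i' hiK') _ ⟨j', h3, h4, rfl⟩
    obtain ⟨h6, h7⟩ := hsegpos k₂ hak hkb i' j' h3 h4
    exact hmono i' hiK' _ _ h6 h7 h1 h2 h5
  · obtain ⟨_, ⟨j', h3, h4, rfl⟩⟩ := seg_nonempty (Γ := Γ) (hF _ hk₂.1) hik₂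
    obtain ⟨h6, h7⟩ := hsegpos k₂ hak hkb i j' h3 h4
    exact h i hik₂ (hav i hiK) _ ⟨j', h3, h4, rfl⟩ (hred j' h6 h7)

/-- In a family `F` without linked pairs, every subfamily of at least two clusters splits by
`exists_split`. Since all sets `S k` lie among `q` paths, this gives `|F| * s + w ≤ q + |F| * w`,
hence `|F| ≤ m`. -/
theorem exists_linked_chain [Fintype V] {m ℓ : ℕ} (hm : ∀ n, n * s + w ≤ q + n * w → n ≤ m)
    (hM : ℓ * m < M) :
    ∃ φ : ℕ → ℕ, (∀ j ≤ ℓ, φ j < M) ∧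
      ∀ j < ℓ, φ j < φ (j + 1) ∧ Γ.Linked (φ j) (φ (j + 1)) := by
  refine exists_chain (m := m) (fun F hF hun => ?_) hM
  rcases F.eq_empty_or_nonempty with rfl | hne
  · simp
  apply hm
  have hFM : ∀ k ∈ F, k < M := fun k hk => Finset.mem_range.1 (hF hk)
  refine (card_mul_le_of_split Γ.S F hne (fun k hk => Γ.card_S k (hFM k hk)) (d := w)
    fun F' hF' h2 => ?_).trans (Nat.add_le_add_right ?_ _)
  · have hne' : F'.Nonempty := Finset.card_pos.1 (by omega)
    have hlt := Finset.min'_lt_max'_of_card F' h2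
    refine exists_split (fun k hk => hFM k (hF' hk)) (F'.min'_mem hne') (F'.max'_mem hne') hlt
      (fun k hk => F'.min'_le k hk) (fun k hk => F'.le_max' k hk) ?_
    exact hun _ (hF' (F'.min'_mem hne')) _ (hF' (F'.max'_mem hne')) hlt
  · simpa using Finset.card_le_univ (F.biUnion Γ.S)

end ClusterSystem

end ClusterLinks

/-! ### From a linked chain of clusters to a strong Path-of-Sets System. -/

section Assembly

theorem HasDisjointPaths.induce {V : Type u} {G H : SimpleGraph V} (hGH : G ≤ H) {Z S T : Set V}
    (hS : S ⊆ Z) {k : ℕ} (h : HasDisjointPaths (within G Z) S T k) :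
    HasDisjointPaths ((⊤ : H.Subgraph).induce Z).coe (Subtype.val ⁻¹' S) (Subtype.val ⁻¹' T) k := by
  suffices HasDisjointPaths (H.induce Z) (Subtype.val ⁻¹' S) (Subtype.val ⁻¹' T) k from
    SimpleGraph.induce_eq_coe_induce_top (G := H) Z ▸ this
  obtain ⟨s, t, P, hs, ht, hP⟩ := h
  have hZ : ∀ i, ∀ x ∈ ((P i).1.mapLe ((within_le G Z).trans hGH)).support, x ∈ Z := by
    intro i x hx
    exact mem_of_mem_support_within (P i).1 (hS (hs i)) x (by simpa using hx)
  refine HasDisjointPaths.of_walks _ _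
    (fun i => ((P i).1.mapLe ((within_le G Z).trans hGH)).induce Z (hZ i)) hs ht
    fun i j hij v hi hj => ?_
  rw [SimpleGraph.Walk.support_induce, List.mem_attachWith] at hi hj
  exact hP hij (by simpa using hi) (by simpa using hj)

theorem connected_induce_of_closed {V : Type u} {G H : SimpleGraph V} (hGH : G ≤ H) {Z : Set V}
    (hne : Z.Nonempty) (h : ∀ U : Set V, (∀ a ∈ Z, ∀ b ∈ Z, a ∈ U → G.Adj a b → b ∈ U) →
      ∀ x ∈ Z, x ∈ U → ∀ v ∈ Z, v ∈ U) : ((⊤ : H.Subgraph).induce Z).Connected := by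
  rw [← SimpleGraph.connected_induce_iff, SimpleGraph.connected_iff_exists_forall_reachable]
  obtain ⟨x, hx⟩ := hne
  refine ⟨⟨x, hx⟩, fun ⟨v, hv⟩ => ?_⟩
  obtain ⟨_, hr⟩ := h {y | ∃ hy : y ∈ Z, (H.induce Z).Reachable ⟨x, hx⟩ ⟨y, hy⟩}
    (fun a ha b hb ⟨_, hr⟩ hab => ⟨hb, hr.trans (SimpleGraph.Adj.reachable
      (SimpleGraph.induce_adj.2 (hGH hab)))⟩) x hx ⟨hx, SimpleGraph.Reachable.refl _⟩ v hv
  exact hr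

theorem IsMinor.refl {V : Type u} (H : SimpleGraph V) : IsMinor H H := by
  refine ⟨fun v => {v}, fun v => ?_, fun a b hab => by simpa using hab, fun a b hab =>
    ⟨a, rfl, b, rfl, hab⟩⟩
  have : Nonempty ({v} : Set V) := ⟨⟨v, rfl⟩⟩
  have : Subsingleton ({v} : Set V) := inferInstance
  exact SimpleGraph.Connected.of_subsingleton

variable {V : Type u} {q κ : ℕ} {Λ : LinkSystem V q κ}

namespace ClusterSystem

variable {M w s : ℕ} {Γ : ClusterSystem Λ M w s}

theorem mem_seg_right {k : ℕ} (hk : k < M) {i : Fin q} (hi : i ∈ Γ.S k) :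
    Λ.r i (Γ.τ (k + 1) i) ∈ Γ.seg k i := by
  have := Γ.seg_len k hk i hi
  exact ⟨_, by omega, le_rfl, rfl⟩

theorem mem_seg_left {k : ℕ} (hk : k < M) {i : Fin q} (hi : i ∈ Γ.S k) :
    Λ.r i (Γ.τ k i + 1) ∈ Γ.seg k i := by
  have := Γ.seg_len k hk i hi
  exact ⟨_, by omega, by omega, rfl⟩

theorem rightEnds_subset {k : ℕ} (hk : k < M) : Γ.rightEnds k ⊆ Γ.Z k := by
  rintro _ ⟨i, hi, rfl⟩
  exact seg_subset_Z hi (mem_seg_right hk hi)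

theorem leftEnds_subset {k : ℕ} (hk : k < M) : Γ.leftEnds k ⊆ Γ.Z k := by
  rintro _ ⟨i, hi, rfl⟩
  exact seg_subset_Z hi (mem_seg_left hk hi)

theorem disjoint_ends {k : ℕ} (hk : k < M) : Disjoint (Γ.leftEnds k) (Γ.rightEnds k) := by
  rw [Set.disjoint_left]
  rintro _ ⟨i, hi, rfl⟩ ⟨i', hi', he⟩
  have h1 := Γ.seg_len k hk i hi
  have h2 := Γ.τ_le (k + 1) i
  obtain ⟨rfl, h3⟩ := Λ.inj _ _ _ _ (by omega) (Γ.τ_le _ _) he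
  omega

theorem le_ncard_rightEnds {k : ℕ} (hk : k < M) : s ≤ (Γ.rightEnds k).ncard := by
  refine (Γ.card_S k hk).trans ?_
  have : Γ.rightEnds k = (fun i => Λ.r i (Γ.τ (k + 1) i)) '' (Γ.S k) := by
    ext v; simp [rightEnds, eq_comm]
  rw [this, Set.InjOn.ncard_image, Set.ncard_coe_finset]
  intro i _ i' _ h
  exact (Λ.inj _ _ _ _ (Γ.τ_le _ _) (Γ.τ_le _ _) h).1

theorem le_ncard_leftEnds {k : ℕ} (hk : k < M) : s ≤ (Γ.leftEnds k).ncard := by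
  refine (Γ.card_S k hk).trans ?_
  have : Γ.leftEnds k = (fun i => Λ.r i (Γ.τ k i + 1)) '' (Γ.S k) := by
    ext v; simp [leftEnds, eq_comm]
  rw [this, Set.InjOn.ncard_image, Set.ncard_coe_finset]
  intro i hi i' hi' h
  have h1 := Γ.seg_len k hk i hi
  have h2 := Γ.τ_le (k + 1) i
  have h3 := Γ.seg_len k hk i' hi'
  have h4 := Γ.τ_le (k + 1) i'
  exact (Λ.inj _ _ _ _ (by omega) (by omega) h).1

/-- A set of vertices on distinct segments of a cluster. -/
def IsTransversal (Γ : ClusterSystem Λ M w s) (k : ℕ) (T : Set V) : Prop :=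
  (∀ t ∈ T, ∃ i ∈ Γ.S k, t ∈ Γ.seg k i) ∧
    ∀ i, ∀ t ∈ T, ∀ t' ∈ T, t ∈ Γ.seg k i → t' ∈ Γ.seg k i → t = t'

theorem IsTransversal.mono {k : ℕ} {T T' : Set V} (h : Γ.IsTransversal k T) (hT : T' ⊆ T) :
    Γ.IsTransversal k T' :=
  ⟨fun t ht => h.1 t (hT ht), fun i t ht t' ht' => h.2 i t (hT ht) t' (hT ht')⟩

theorem IsTransversal.subset {k : ℕ} {T : Set V} (h : Γ.IsTransversal k T) : T ⊆ Γ.Z k := by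
  intro t ht
  obtain ⟨i, hi, hti⟩ := h.1 t ht
  exact seg_subset_Z hi hti

theorem isTransversal_rightEnds {k : ℕ} (hk : k < M) : Γ.IsTransversal k (Γ.rightEnds k) := by
  constructor
  · rintro _ ⟨i, hi, rfl⟩
    exact ⟨i, hi, mem_seg_right hk hi⟩
  · rintro i _ ⟨i₁, hi₁, rfl⟩ _ ⟨i₂, hi₂, rfl⟩ h1 h2
    rw [eq_of_mem_seg (mem_seg_right hk hi₁) h1, eq_of_mem_seg (mem_seg_right hk hi₂) h2]

theorem isTransversal_leftEnds {k : ℕ} (hk : k < M) : Γ.IsTransversal k (Γ.leftEnds k) := by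
  constructor
  · rintro _ ⟨i, hi, rfl⟩
    exact ⟨i, hi, mem_seg_left hk hi⟩
  · rintro i _ ⟨i₁, hi₁, rfl⟩ _ ⟨i₂, hi₂, rfl⟩ h1 h2
    rw [eq_of_mem_seg (mem_seg_left hk hi₁) h1, eq_of_mem_seg (mem_seg_left hk hi₂) h2]

/-- Subsets of transversals of size at most `w` are linked in the subgraph induced by a cluster. -/
theorem IsTransversal.hasDisjointPaths [Fintype V] {H : SimpleGraph V} (hH : Λ.G ≤ H) {k : ℕ}
    (hk : k < M) {A B : Set V} (hA : Γ.IsTransversal k A) (hB : Γ.IsTransversal k B)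
    (hAw : A.ncard ≤ w) {T₁ T₂ : Set ((⊤ : H.Subgraph).induce (Γ.Z k)).verts}
    (h₁ : T₁ ⊆ Subtype.val ⁻¹' A) (h₂ : T₂ ⊆ Subtype.val ⁻¹' B) :
    HasDisjointPaths ((⊤ : H.Subgraph).induce (Γ.Z k)).coe T₁ T₂ (min T₁.ncard T₂.ncard) := by
  have hA' : Γ.IsTransversal k (Subtype.val '' T₁) := hA.mono (Set.image_subset_iff.2 h₁)
  have hB' : Γ.IsTransversal k (Subtype.val '' T₂) := hB.mono (Set.image_subset_iff.2 h₂)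
  have e₁ := Set.ncard_image_of_injective T₁ Subtype.val_injective
  have e₂ := Set.ncard_image_of_injective T₂ Subtype.val_injective
  have hle : T₁.ncard ≤ w := by
    rw [← e₁]
    exact (Set.ncard_le_ncard (Set.image_subset_iff.2 h₁) (Set.toFinite _)).trans hAw
  have := (hasDisjointPaths_cluster hk (m := min T₁.ncard T₂.ncard) (by omega) hA'.1 hA'.2 hB'.1
    hB'.2 (by omega) (by omega)).induce hH hA'.subset
  rwa [Set.preimage_image_eq _ Subtype.val_injective,
    Set.preimage_image_eq _ Subtype.val_injective] at this

theorem disjoint_Z {k k' : ℕ} (hk : k < k') (hk' : k' < M) : Disjoint (Γ.Z k) (Γ.Z k') := by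
  rw [Set.disjoint_left]
  intro v h h'
  exact (mem_slice hk' h').2 (Γ.mono hk (mem_slice (hk.trans hk') h).1)

/-- The delicate case is `b = a'`: the two regions then touch the same cluster, one in its left ends
and the other in its right ends, which are disjoint. -/
theorem disjoint_between {a b a' b' : ℕ} (hab : a < b) (hba : b ≤ a') (hab' : a' < b')
    (hM : b' < M) : Disjoint (Γ.between a b) (Γ.between a' b') := by
  rw [Set.disjoint_left]
  have hR : ∀ k < M, ∀ v ∈ Γ.rightEnds k, v ∈ Γ.U (k + 1) ∧ v ∉ Γ.U k := fun k hk v hv =>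
    mem_slice hk (rightEnds_subset hk hv)
  have hL : ∀ k < M, ∀ v ∈ Γ.leftEnds k, v ∈ Γ.U (k + 1) ∧ v ∉ Γ.U k := fun k hk v hv =>
    mem_slice hk (leftEnds_subset hk hv)
  intro v h h'
  have h1 : v ∈ Γ.U (b + 1) := by
    rcases h with h | h | h
    · exact Γ.mono (by omega) (hR a (by omega) v h).1
    · exact (hL b (by omega) v h).1
    · exact Γ.mono (by omega) h.1
  rcases h' with h' | h' | h'
  · have h2 := (hR a' (by omega) v h').2
    rcases h with h | h | h
    · exact h2 (Γ.mono (show a + 1 ≤ a' by omega) (hR a (by omega) v h).1)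
    · rcases hba.eq_or_lt with rfl | hlt
      · exact Set.disjoint_left.1 (disjoint_ends (by omega)) h h'
      · exact h2 (Γ.mono hlt h1)
    · exact h2 (Γ.mono hba h.1)
  · exact (hL b' hM v h').2 (Γ.mono (by omega) h1)
  · exact h'.2 (Γ.mono (by omega) h1)

/-- A linked chain of clusters gives a strong Path-of-Sets System. -/
theorem exists_pathOfSetsSystem [Fintype V] {H : SimpleGraph V} (hH : Λ.G ≤ H) {ℓ : ℕ} (hℓ : 0 < ℓ)
    (hw : 0 < w) (hws : w ≤ s) {φ : ℕ → ℕ} (hφM : ∀ j < ℓ, φ j < M)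
    (hφ : ∀ j < ℓ - 1, φ j < φ (j + 1) ∧ Γ.Linked (φ j) (φ (j + 1))) :
    ∃ S : PathOfSetsSystem H ℓ w, S.IsStrong := by
  have hle : ∀ i j, i ≤ j → j < ℓ → φ i ≤ φ j := by
    intro i j hij hj
    induction j, hij using Nat.le_induction with
    | base => exact le_rfl
    | succ j hij ih => exact (ih (by omega)).trans (hφ j (by omega)).1.le
  have hlt : ∀ i j, i < j → j < ℓ → φ i < φ j := fun i j hij hj =>
    (hφ i (by omega)).1.trans_le (hle _ _ hij hj)
  choose src tgt P hsrc htgt hP hPtrim using fun j : Fin (ℓ - 1) => (hφ j j.2).2.trimmed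
  -- The ends of the linkage to the next cluster determine `B j`; in the last cluster any `w` right
  -- ends do. `A j` is chosen symmetrically.
  have hB : ∀ j : Fin ℓ, ∃ B ⊆ Γ.rightEnds (φ j), B.ncard = w ∧
      ∀ i : Fin (ℓ - 1), i.1 = j.1 → ∀ k, src i k ∈ B := by
    rintro ⟨j, hj⟩
    by_cases h : j < ℓ - 1
    · refine ⟨Set.range (src ⟨j, h⟩), Set.range_subset_iff.2 (hsrc ⟨j, h⟩), ?_, ?_⟩
      · rw [← Set.image_univ, Set.ncard_image_of_injective _
          (HasDisjointPaths.start_injective _ (hP ⟨j, h⟩)), Set.ncard_univ]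
        simp
      · rintro ⟨i, hi⟩ rfl k
        exact ⟨k, rfl⟩
    · obtain ⟨B, hB, hBw⟩ := Set.exists_subset_card_eq
        (hws.trans (le_ncard_rightEnds (Γ := Γ) (hφM j hj)))
      exact ⟨B, hB, hBw, fun i hi => absurd (lt_of_eq_of_lt hi.symm i.2) h⟩
  have hA : ∀ j : Fin ℓ, ∃ A ⊆ Γ.leftEnds (φ j), A.ncard = w ∧
      ∀ i : Fin (ℓ - 1), i.1 + 1 = j.1 → ∀ k, tgt i k ∈ A := by
    rintro ⟨_ | j, hj⟩
    · obtain ⟨A, hA, hAw⟩ := Set.exists_subset_card_eq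
        (hws.trans (le_ncard_leftEnds (Γ := Γ) (hφM 0 hj)))
      exact ⟨A, hA, hAw, fun i hi => absurd hi (by simp)⟩
    · have h : j < ℓ - 1 := by omega
      refine ⟨Set.range (tgt ⟨j, h⟩), Set.range_subset_iff.2 (htgt ⟨j, h⟩), ?_, ?_⟩
      · rw [← Set.image_univ, Set.ncard_image_of_injective _
          (HasDisjointPaths.end_injective _ (hP ⟨j, h⟩)), Set.ncard_univ]
        simp
      · rintro ⟨i, hi⟩ he k
        obtain rfl : i = j := by simpa using he
        exact ⟨k, rfl⟩
  choose B hBr hBw hBmem using hB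
  choose A hAl hAw hAmem using hA
  have hbetween : ∀ i k, ∀ x ∈ (P i k).1.support, x ∈ Γ.between (φ i) (φ (i + 1)) :=
    fun i k => mem_of_mem_support_within _ (Or.inl (hsrc i k))
  have hGH : ∀ i : Fin (ℓ - 1), within Λ.G (Γ.between (φ i) (φ (i + 1))) ≤ H :=
    fun i => (within_le _ _).trans hH
  have hdis : ∀ i i' : Fin (ℓ - 1), i < i' → ∀ k k',
      (P i k).1.support.Disjoint (P i' k').1.support := by
    intro i i' hii k k' x hx hx'
    have h1 := i'.2
    exact Set.disjoint_left.1 (disjoint_between (hφ i i.2).1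
      (hle (i + 1) i' (Nat.succ_le_of_lt hii) (by omega)) (hφ i' h1).1 (hφM _ (by omega)))
      (hbetween i k x hx) (hbetween i' k' x hx')
  have hAt : ∀ j : Fin ℓ, Γ.IsTransversal (φ j) (A j) := fun j =>
    (isTransversal_leftEnds (hφM j j.2)).mono (hAl j)
  have hBt : ∀ j : Fin ℓ, Γ.IsTransversal (φ j) (B j) := fun j =>
    (isTransversal_rightEnds (hφM j j.2)).mono (hBr j)
  refine ⟨{ length_pos := hℓ
            width_pos := hw
            C := fun j => (⊤ : H.Subgraph).induce (Γ.Z (φ j))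
            C_connected := fun j => ?_
            C_disjoint := fun i j hij => ?_
            A := A
            B := B
            A_subset := fun j => (hAt j).subset
            B_subset := fun j => (hBt j).subset
            A_disjoint_B := fun j => (disjoint_ends (hφM j j.2)).mono (hAl j) (hBr j)
            A_ncard := hAw
            B_ncard := hBw
            src := src
            tgt := tgt
            P := fun i k => ⟨(P i k).1.mapLe (hGH i), (P i k).2.mapLe (hGH i)⟩
            src_mem := fun i k => hBmem _ i rfl k
            tgt_mem := fun i k => hAmem _ i rfl k
            P_disjoint := ?_
            P_internal := ?_ }, fun j => ⟨?_, ?_, ?_⟩⟩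
  · have hne : (Γ.S (φ j)).Nonempty := Finset.card_pos.1
      (hw.trans_le (hws.trans (Γ.card_S _ (hφM j j.2))))
    obtain ⟨i, hi⟩ := hne
    exact connected_induce_of_closed hH ((seg_nonempty (hφM j j.2) hi).mono (seg_subset_Z hi))
      fun U hU x hx hxU => cluster_connected (hφM j j.2) hU hx hxU
  · rcases lt_or_gt_of_ne hij with h | h
    · exact disjoint_Z (hlt i j h j.2) (hφM j j.2)
    · exact (disjoint_Z (hlt j i h i.2) (hφM i i.2)).symm
  · rintro ⟨i, k⟩ ⟨i', k'⟩ hne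
    suffices (P i k).1.support.Disjoint (P i' k').1.support by simpa using this
    rcases lt_trichotomy i i' with h | rfl | h
    · exact hdis _ _ h _ _
    · exact hP i fun h => hne (by rw [h])
    · exact (hdis _ _ h _ _).symm
  · intro i k j x hx hxZ
    have hx' : x ∈ (P i k).1.support := by simpa using hx
    obtain ⟨h1, h2⟩ := mem_slice (hφM j j.2) hxZ
    -- A path may run through clusters skipped by the chain, but it meets those of the chain only in
    -- right ends of one and left ends of the next, where trimming leaves just its own endpoints.
    rcases hbetween i k x hx' with h | h | ⟨h3, h4⟩
    · exact Or.inl ((hPtrim i k x hx').1 h)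
    · exact Or.inr ((hPtrim i k x hx').2 h)
    · exfalso
      rcases Nat.lt_or_ge i.1 j.1 with h | h
      · exact h2 (Γ.mono (hle _ _ h j.2) h3)
      · have h5 := i.2
        exact h4 (Γ.mono (Nat.succ_le_succ (hle _ _ h (by omega))) h1)
  · exact fun T₁ T₂ h₁ h₂ _ =>
      (hAt j).hasDisjointPaths hH (hφM j j.2) (hAt j) (hAw j).le h₁ h₂
  · exact fun T₁ T₂ h₁ h₂ _ =>
      (hBt j).hasDisjointPaths hH (hφM j j.2) (hBt j) (hBw j).le h₁ h₂
  · exact fun T₁ T₂ h₁ h₂ =>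
      (hAt j).hasDisjointPaths hH (hφM j j.2) (hBt j) (hAw j).le h₁ h₂

end ClusterSystem

end Assembly

/-! ### Counting incidences and choosing the parameters. -/

section Density

theorem LinkSystem.exists_walk {V : Type u} {q κ : ℕ} (Λ : LinkSystem V q κ) (i : Fin q) {j : ℕ}
    (hj : j ≤ Λ.len i) :
    ∃ p : Λ.G.Walk (Λ.r i 0) (Λ.r i j), ∀ v ∈ p.support, v ∈ Λ.path i := by
  induction j with
  | zero => exact ⟨.nil, by simpa using ⟨0, hj, rfl⟩⟩
  | succ j ih =>
    obtain ⟨p, hp⟩ := ih (by omega)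
    refine ⟨p.concat (Λ.adj i j hj), fun v hv => ?_⟩
    rw [SimpleGraph.Walk.support_concat, List.mem_append, List.mem_singleton] at hv
    rcases hv with hv | rfl
    · exact hp v hv
    · exact ⟨_, hj, rfl⟩

theorem exists_adj_of_mem_support {V : Type u} {G : SimpleGraph V} {a b : V} (p : G.Walk a b)
    {U : Set V} (h₁ : ∃ v ∈ p.support, v ∈ U) (h₂ : ∃ v ∈ p.support, v ∉ U) :
    ∃ x ∈ p.support, ∃ y ∈ p.support, x ∈ U ∧ y ∉ U ∧ G.Adj x y := by
  by_contra hcon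
  push Not at hcon
  have key : ∀ v ∈ p.support, (v ∈ U ↔ a ∈ U) := by
    clear h₁ h₂
    induction p with
    | nil => simp
    | @cons a c b h p ih =>
      have hac : c ∈ U ↔ a ∈ U := by
        have hc : c ∈ (SimpleGraph.Walk.cons h p).support := by simp
        have ha : a ∈ (SimpleGraph.Walk.cons h p).support := by simp
        constructor
        · intro hcU
          by_contra haU
          exact hcon c hc a ha hcU haU h.symm
        · intro haU
          by_contra hcU
          exact hcon a ha c hc haU hcU h
      intro v hv
      rw [SimpleGraph.Walk.support_cons, List.mem_cons] at hv
      rcases hv with rfl | hv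
      · rfl
      · rw [← hac]
        refine ih (fun x hx y hy => hcon x ?_ y ?_) v hv <;>
          simp [SimpleGraph.Walk.support_cons, hx, hy]
  obtain ⟨v, hv, hvU⟩ := h₁
  obtain ⟨v', hv', hvU'⟩ := h₂
  exact hvU' ((key v' hv').2 ((key v hv).1 hvU))

theorem sum_le_of_card_filter_le {ι : Type*} {D : Finset ι} {f : ι → ℕ} {h₁ h₂ q n₁ n₂ : ℕ}
    (hq : ∀ p ∈ D, f p ≤ q) (hn₁ : (D.filter fun p => h₁ ≤ f p).card ≤ n₁)
    (hn₂ : (D.filter fun p => h₂ ≤ f p).card ≤ n₂) :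
    ∑ p ∈ D, f p ≤ D.card * h₁ + n₁ * h₂ + n₂ * q := by
  calc ∑ p ∈ D, f p ≤ ∑ p ∈ D, (h₁ + (if h₁ ≤ f p then h₂ else 0) + if h₂ ≤ f p then q else 0) := by
        refine Finset.sum_le_sum fun p hp => ?_
        have := hq p hp
        split_ifs <;> omega
    _ = D.card * h₁ + (D.filter fun p => h₁ ≤ f p).card * h₂ +
          (D.filter fun p => h₂ ≤ f p).card * q := by
        rw [Finset.sum_add_distrib, Finset.sum_add_distrib, ← Finset.sum_filter,
          ← Finset.sum_filter]
        simp
    _ ≤ _ := by gcongr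

theorem hitCount_le {V : Type u} {q : ℕ} (R : Fin q → Set V) (C : Set V) : hitCount R C ≤ q := by
  simpa [hitCount] using Set.ncard_le_card (s := {i | (R i ∩ C).Nonempty})

theorem LinkSystem.disjoint_path {V : Type u} {q κ : ℕ} (Λ : LinkSystem V q κ) :
    Pairwise fun i j => Disjoint (Λ.path i) (Λ.path j) := by
  intro i i' hne
  rw [Set.disjoint_left]
  rintro _ ⟨j, hj, rfl⟩ ⟨j', hj', he⟩
  exact hne (Λ.inj _ _ _ _ hj hj' he.symm).1

/-- Without a crossbar, there is a link system in which many crossings between its paths and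
disjoint connected sets occur. -/
theorem exists_dense_linkSystem {V : Type u} [Fintype V] {H : SimpleGraph V} {A B X : Set V}
    {κ ρ q L : ℕ} (hA : A.ncard = κ) (hAB : HasDisjointPaths H A B κ)
    (hAX : HasDisjointPaths H A X κ) (hno : ¬ Nonempty (Crossbar H A B X ρ))
    (hκ : L * ρ + q ≤ κ) :
    ∃ (Λ : LinkSystem V q κ) (D : Finset (Fin κ)), Λ.G ≤ H ∧ D.card ≤ L * ρ ∧
      L * q ≤ ∑ p ∈ D, hitCount Λ.path (Λ.C p) + L * ρ := by
  classical
  obtain ⟨a, b, P, ha, hb, hP⟩ := hAB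
  obtain ⟨s, t, Q, hs, ht, hQ⟩ := hAX
  obtain ⟨S, Y, hS, hY, hSd, hlay⟩ := exists_layers (X := X) P ha hb hP hno
  have hainj := HasDisjointPaths.start_injective P hP
  have hsinj := HasDisjointPaths.start_injective Q hQ
  set D := (Finset.range L).biUnion S with hD
  have hDcard : D.card ≤ L * ρ := by
    refine (Finset.card_biUnion_le_card_mul _ _ ρ fun k _ => (hS k).le).trans ?_
    simp
  -- Since `A` has exactly `κ` elements, the starts of the paths `P` exhaust it.
  have hasurj : ∀ i, ∃ j, a j = s i := fun i =>
    exists_eq_of_injective hainj (Y := A.toFinset) (by simpa using ha)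
      (by rw [← hA, Set.ncard_eq_toFinset_card']) (by simpa using hs i)
  choose f hfs using hasurj
  have hfinj : Function.Injective f := fun i j hij => hsinj (by
    rw [← hfs i, ← hfs j]; exact congrArg a hij)
  -- The layers contain at most `L * ρ ≤ κ - q` paths, so at least `q` of the A–X paths start
  -- outside them.
  have hI : q ≤ (Finset.univ.filter fun i => f i ∉ D).card := by
    have h1 : (Finset.univ.filter fun i => f i ∈ D).card ≤ D.card :=
      Finset.card_le_card_of_injOn f (by intro i hi; simpa using hi)
        hfinj.injOn
    have h2 := Finset.card_filter_add_card_filter_not (s := (Finset.univ : Finset (Fin κ)))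
      fun i => f i ∈ D
    rw [Finset.card_univ, Fintype.card_fin] at h2
    omega
  obtain ⟨I, hI, hIq⟩ := Finset.exists_subset_card_eq hI
  let e : Fin q → Fin κ := I.orderEmbOfFin hIq
  have he : Function.Injective e := (I.orderEmbOfFin hIq).injective
  have heI : ∀ i, f (e i) ∉ D := fun i =>
    (Finset.mem_filter.1 (hI (I.orderEmbOfFin_mem hIq i))).2
  obtain ⟨Λ, hΛH, hΛC, hΛs, hΛt⟩ := exists_linkSystem (H := H) (q := q)
    (C := fun p => (P p).1.support.toFinset)
    (fun p p' hpp => by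
      refine Finset.disjoint_left.2 fun v hv hv' => ?_
      exact hP hpp (by simpa using hv) (by simpa using hv'))
    (fun p U h1 h2 => by
      simpa using exists_adj_of_mem_support (P p).1 (by simpa using h1) (by simpa using h2))
    (src := Finset.univ.image fun i => s (e i)) (snk := Finset.univ.image fun i => t (e i))
    (Finset.card_image_le.trans (by simp)) (Finset.card_image_le.trans (by simp))
    ⟨fun i => s (e i), fun i => t (e i), fun i => Q (e i), by simp, by simp,
      fun i j hij => hQ (he.ne hij)⟩
  refine ⟨Λ, D, hΛH, hDcard, ?_⟩
  have hk : ∀ k < L, q ≤ ∑ p ∈ S k, hitCount Λ.path (Λ.C p) + ρ := by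
    intro k hkL
    refine card_le_sum_hitCount (C := fun p => (Λ.C p : Set V)) Λ.disjoint_path (hY k) fun i => ?_
    have h0 := Λ.start_mem i
    have h1 := Λ.end_mem i
    rw [hΛs] at h0
    rw [hΛt] at h1
    obtain ⟨i₀, -, h0⟩ := Finset.mem_image.1 h0
    obtain ⟨i₁, -, h1⟩ := Finset.mem_image.1 h1
    obtain ⟨p, hp⟩ := Λ.exists_walk i le_rfl
    have hstart : Λ.r i 0 = a (f (e i₀)) := by rw [hfs, h0]
    -- A rerouted path still runs from an unlayered vertex of `A` to `X` in `H`, so each of the `L`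
    -- layers must intercept it.
    have := hlay k (f (e i₀)) (fun j hj hmem => heI i₀ (Finset.mem_biUnion.2
      ⟨j, Finset.mem_range.2 (hj.trans hkL), hmem⟩)) _ (h1 ▸ ht (e i₁))
      ((p.mapLe hΛH).copy hstart rfl)
    rw [hΛC]
    simp only [SimpleGraph.Walk.support_copy, SimpleGraph.Walk.support_mapLe_eq_support] at this
    rcases this with ⟨v, hv, hvY⟩ | ⟨v, hv, x, hx, hvx⟩
    · exact Or.inl ⟨v, hp v hv, hvY⟩
    · exact Or.inr ⟨v, hp v hv, x, hx, by simpa using hvx⟩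
  have hsum : ∑ p ∈ D, hitCount Λ.path (Λ.C p) =
      ∑ k ∈ Finset.range L, ∑ p ∈ S k, hitCount Λ.path (Λ.C p) := by
    refine Finset.sum_biUnion fun i _ j _ hij => ?_
    rcases lt_or_gt_of_ne hij with h | h
    · exact hSd i j h
    · exact (hSd j i h).symm
  calc L * q = ∑ k ∈ Finset.range L, q := by simp
    _ ≤ ∑ k ∈ Finset.range L, (∑ p ∈ S k, hitCount Λ.path (Λ.C p) + ρ) :=
        Finset.sum_le_sum fun k hk' => hk k (Finset.mem_range.1 hk')
    _ = _ := by rw [Finset.sum_add_distrib, hsum]; simp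

/-- Many sets with many crossings give a strong Path-of-Sets System. -/
theorem exists_pathOfSetsSystem_of_hitCount {V : Type u} [Fintype V] {H : SimpleGraph V} {q κ : ℕ}
    {Λ : LinkSystem V q κ} (hΛ : Λ.G ≤ H) {D : Finset (Fin κ)} {N M h w α b ℓ m : ℕ} (hw : 0 < w)
    (hℓ : 0 < ℓ) (hα : 4 * w ≤ α) (hb : 4 * w ≤ b) (hq : 2 * w ≤ q) (hN : 2 * w ≤ N)
    (hαN : 2 * (α * q) ≤ N * h) (hbh : 2 * b ≤ h)
    (hD : ∀ p ∈ D, h ≤ hitCount Λ.path (Λ.C p)) (hM : q + M * (N + 2 * q) ≤ D.card)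
    (hm : ∀ n, n * b + w ≤ q + n * w → n ≤ m) (hℓM : ℓ * m < M) :
    ∃ S : PathOfSetsSystem H ℓ w, S.IsStrong := by
  obtain ⟨Γ⟩ := exists_clusterSystem hw hα hb hq hN hαN hbh hD hM
  obtain ⟨φ, hφM, hφ⟩ := Γ.exists_linked_chain hm hℓM
  exact Γ.exists_pathOfSetsSystem hΛ hℓ hw (by omega) (fun j hj => hφM j hj.le)
    fun j hj => hφ j (by omega)

/-- The incidences number about `2 ^ 28 * g ^ 11`. Two thresholds for `hitCount` are used: bounding
every count above `32 * g ^ 2` by `q = 256 * g ^ 4` would allow order `g ^ 12`, whereas with an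
intermediate threshold of order `g ^ 3` the contributions are `g ^ 8 * g ^ 3` and `g ^ 7 * g ^ 4`.
-/
theorem exists_crossbar_or_pathOfSetsSystem {V : Type u} [Fintype V] {H : SimpleGraph V}
    {A B X : Set V} {g κ : ℕ} (hg : 2 ≤ g) (hA : A.ncard = κ) (hκ : 2 ^ 22 * g ^ 9 ≤ κ)
    (hAB : HasDisjointPaths H A B κ) (hAX : HasDisjointPaths H A X κ) :
    Nonempty (Crossbar H A B X (g ^ 2)) ∨
      ∃ S : PathOfSetsSystem H (g ^ 2) (g ^ 2), S.IsStrong := by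
  classical
  by_contra hcon
  rw [not_or] at hcon
  obtain ⟨hno, hnoS⟩ := hcon
  have hg0 : 0 < g := by omega
  have hpow : ∀ {m n : ℕ}, m ≤ n → g ^ m ≤ g ^ n := fun h => Nat.pow_le_pow_right hg0 h
  have e9 : g ^ 9 = g ^ 7 * g ^ 2 := by ring
  have h49 := hpow (show 4 ≤ 9 by norm_num)
  obtain ⟨Λ, D, hΛ, hD, hsum⟩ := exists_dense_linkSystem (ρ := g ^ 2) (q := 256 * g ^ 4)
    (L := 2 ^ 20 * g ^ 7) hA hAB hAX hno (by
      rw [mul_assoc, ← e9]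
      omega)
  have hg2 : 0 < g ^ 2 := by positivity
  have h24 := hpow (show 2 ≤ 4 by norm_num)
  have h23 := hpow (show 2 ≤ 3 by norm_num)
  have h48 := hpow (show 4 ≤ 8 by norm_num)
  have h47 := hpow (show 4 ≤ 7 by norm_num)
  have h911 := hpow (show 9 ≤ 11 by norm_num)
  -- Here `15 * n ≤ 256 * g ^ 2` bounds unlinked families by `18 * g ^ 2`, so `19 * g ^ 4` slices
  -- suffice. Each costs `576 * g ^ 4` sets, and the initial `q` brings the total within `11200 * g
  -- ^ 8`.
  have hmid : (D.filter fun p => 32 * g ^ 2 ≤ hitCount Λ.path (Λ.C p)).card ≤ 11200 * g ^ 8 := by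
    by_contra hlt
    rw [not_le] at hlt
    refine hnoS (exists_pathOfSetsSystem_of_hitCount hΛ
      (D := D.filter fun p => 32 * g ^ 2 ≤ hitCount Λ.path (Λ.C p)) (h := 32 * g ^ 2) (N := 64 * g ^ 4) (M := 19 * g ^ 4)
      (α := 4 * g ^ 2) (b := 16 * g ^ 2) (m := 18 * g ^ 2) hg2 hg2 le_rfl (by omega) (by omega)
      (by omega) (le_of_eq (by ring)) (by omega) (fun p hp => (Finset.mem_filter.1 hp).2) ?_ ?_ ?_)
    · refine le_trans ?_ hlt.le
      have : 19 * g ^ 4 * (64 * g ^ 4 + 2 * (256 * g ^ 4)) = 10944 * g ^ 8 := by ring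
      omega
    · intro n hn
      have e4 : g ^ 4 = g ^ 2 * g ^ 2 := by ring
      rw [e4] at hn
      have : n * 15 ≤ 256 * g ^ 2 := by nlinarith
      omega
    · have : g ^ 2 * (18 * g ^ 2) = 18 * g ^ 4 := by ring
      have : 0 < g ^ 4 := by positivity
      omega
  -- Larger clusters overlap more: unlinked families have at most `3 * g` members, so only `4 * g ^
  -- 3` slices are needed, each costing little more than `2 * q = 512 * g ^ 4`.
  have hhigh : (D.filter fun p => 256 * g ^ 3 ≤ hitCount Λ.path (Λ.C p)).card ≤ 2400 * g ^ 7 := by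
    by_contra hlt
    rw [not_le] at hlt
    have h13 : g ^ 2 * 2 ≤ g ^ 3 := by rw [pow_succ g 2]; exact Nat.mul_le_mul_left _ hg
    refine hnoS (exists_pathOfSetsSystem_of_hitCount hΛ
      (D := D.filter fun p => 256 * g ^ 3 ≤ hitCount Λ.path (Λ.C p)) (h := 256 * g ^ 3) (N := 8 * g ^ 3) (M := 4 * g ^ 3)
      (α := 4 * g ^ 2) (b := 128 * g ^ 3) (m := 3 * g) hg2 hg2 le_rfl (by omega) (by omega)
      (by omega) (le_of_eq (by ring)) (by omega) (fun p hp => (Finset.mem_filter.1 hp).2) ?_ ?_ ?_)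
    · refine le_trans ?_ hlt.le
      have : 4 * g ^ 3 * (8 * g ^ 3 + 2 * (256 * g ^ 4)) = 32 * g ^ 6 + 2048 * g ^ 7 := by ring
      have h67 := hpow (show 6 ≤ 7 by norm_num)
      omega
    · intro n hn
      have e4 : g ^ 4 = g * g ^ 3 := by ring
      rw [e4] at hn
      have h3 : 0 < g ^ 3 := by positivity
      have h5 : n * g ^ 2 ≤ n * g ^ 3 := Nat.mul_le_mul_left _ h23
      have : n * 127 ≤ 256 * g := by
        refine Nat.le_of_mul_le_mul_right ?_ h3
        nlinarith
      omega
    · have : g ^ 2 * (3 * g) = 3 * g ^ 3 := by ring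
      have : 0 < g ^ 3 := by positivity
      omega
  have hle := sum_le_of_card_filter_le (fun p _ => hitCount_le Λ.path (Λ.C p : Set V)) hmid hhigh
  have h1 := Nat.mul_le_mul_right (32 * g ^ 2) hD
  have e1 : 2 ^ 20 * g ^ 7 * g ^ 2 * (32 * g ^ 2) = 2 ^ 25 * g ^ 11 := by ring
  have e2 : 11200 * g ^ 8 * (256 * g ^ 3) = 2867200 * g ^ 11 := by ring
  have e3 : 2400 * g ^ 7 * (256 * g ^ 4) = 614400 * g ^ 11 := by ring
  have e4 : 2 ^ 20 * g ^ 7 * (256 * g ^ 4) = 2 ^ 28 * g ^ 11 := by ring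
  have e5 : 2 ^ 20 * g ^ 7 * g ^ 2 = 2 ^ 20 * g ^ 9 := by ring
  rw [e1] at h1
  rw [e2, e3] at hle
  rw [e4, e5] at hsum
  have h11 : 0 < g ^ 11 := by positivity
  -- The contradiction is `2 ^ 28 ≤ 2 ^ 25 + 2867200 + 614400 + 2 ^ 20`, after bounding `g ^ 9` by
  -- `g ^ 11`.
  omega

end Density

end CrossbarThm

/-- The constant is `c = 1` and the minor is `H` itself; the logarithm enters only through `log g ≥
1`. -/
theorem mainTheorem2 :
    ∃ c : ℝ, 0 < c ∧
      ∀ (V : Type u) [Finite V] (H : SimpleGraph V) (g κ : ℕ) (A B X : Set V),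
        2 ≤ g → (∃ k : ℕ, g = 2 ^ k) →
        Disjoint A B → Disjoint A X → Disjoint B X →
        A.ncard = κ → B.ncard = κ → X.ncard = κ →
        (2 : ℝ) ^ 22 * (g : ℝ) ^ 9 * Real.logb 2 (g : ℝ) ≤ (κ : ℝ) →
        (∀ x ∈ X, (H.neighborSet x).ncard = 1) →
        CrossbarThm.HasDisjointPaths H A B κ →
        CrossbarThm.HasDisjointPaths H A X κ →
        Nonempty (CrossbarThm.Crossbar H A B X (g ^ 2)) ∨
          ∃ (W : Type u) (_ : Finite W) (H' : SimpleGraph W) (ℓ w : ℕ)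
            (S : CrossbarThm.PathOfSetsSystem H' ℓ w),
            CrossbarThm.IsMinor H' H ∧ S.IsStrong ∧
              c * (g : ℝ) ^ 2 ≤ (ℓ : ℝ) ∧ c * (g : ℝ) ^ 2 ≤ (w : ℝ) := by
  refine ⟨1, one_pos, ?_⟩
  intro V hV H g κ A B X hg _ _ _ _ hA _ _ hκ _ hAB hAX
  have := Fintype.ofFinite V
  have hlog : (1 : ℝ) ≤ Real.logb 2 g := by
    rw [Real.le_logb_iff_rpow_le one_lt_two (by positivity)]
    simpa using (by exact_mod_cast hg : (2 : ℝ) ≤ g)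
  have hκ' : 2 ^ 22 * g ^ 9 ≤ κ := by
    have h : (2 : ℝ) ^ 22 * (g : ℝ) ^ 9 ≤ κ :=
      (le_mul_of_one_le_right (by positivity) hlog).trans hκ
    exact_mod_cast h
  rcases CrossbarThm.exists_crossbar_or_pathOfSetsSystem hg hA hκ' hAB hAX with h | ⟨S, hS⟩
  · exact Or.inl h
  · exact Or.inr ⟨V, hV, H, g ^ 2, g ^ 2, S, CrossbarThm.IsMinor.refl H, hS, by simp, by simp⟩
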